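/- Let $\pi:\mathbb R^3\to\mathbb R^2$, $\pi(x,y,z)=(x,y)$, and identify $\mathbb R^2$ with the $xy$-plane of $\mathbb R^3$. A *polyhedron* is the convex hull of a finite subset of $\mathbb R^3$, and a *rigid motion* is a map $x\mapsto gx+t$ with $g\in SO(3)$, $t\in\mathbb R^3$. For $\rho\in SO(3)$ let $|\rho|\in[0,\pi]$ be its rotation angle. A set $Q\subseteq\mathbb R^3$ is *locally Rupert* if it has an image $Q'$ under a rigid motion such that for every $\varepsilon>0$ there is $\rho\in SO(3)$ with $|\rho|<\varepsilon$ and $\pi(\rho(Q'))\subseteq\operatorname{int}\pi(Q')$. It is *locally reverse Rupert* if it has an image $Q'$ under a rigid motion such that for every $\varepsilon>0$ there is $\rho\in SO(3)$ with $|\rho|<\varepsilon$ and $\pi(Q')\subseteq\operatorname{int}\pi(\rho(Q'))$. (Interiors are taken in $\mathbb R^2$.) A *nontrivial arch* with endpoints $(a,0),(b,0)$, $a<b$, is the convex hull of these two points and a finite nonempty set of points $(x,y)$ with $a<x<b$ and $y>0$. A planar set is *nontrivial double-arch* if it is congruent to the union of a nontrivial arch and the reflection in the $x$-axis of another nontrivial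 arch with the same endpoints. Let $P\subset\mathbb R^2$ be a convex polygon with boundary $\partial P$ in $\mathbb R^2$. Then $P$ is a *polygonal section* of $Q$ if $Q\cap\{z=0\}=P$ and $\pi^{-1}(\partial P)\cap Q=\partial P$. The set $Q$ has a *prism section over $P$* if, for some $h,h'>0$, $Q\cap\{-h\le z\le h\}=\{(x,y,z):(x,y)\in P,\ -h'\le z\le h'\}$. **Statement.** Let $Q$ be a polyhedron, let $c$ be a point in the interior of $Q$, let $r>0$, and let $$D=\{y\in\mathbb R^3:\ \langle x-c,\,y-c\rangle\le r^2\ \text{for all } x\in Q\}$$ be the dual of $Q$ with respect to the sphere with centre $c$ and radius $r$. Let $n$ be a natural number. Consider the conditions: (A) for some rigid motion $T$, $T(Q)$ has a polygonal section $P$ that is a nontrivial double-arch regular $n$-gon (in particular $n\ge 3$) with centre $T(c)$; (B) for some rigid motion $T$, $T(D)$ has a prism section over a polygon $P$ that is a nontrivial double-arch regular $n$-gon (in particular $n\ge 3$) with centre $T(c)$. Then (A) holds if and only if (B) holds. Moreover, if (A) holds then $Q$ is locally Rupert, and if (B) holds then $D$ is locally reverse Rupert. -/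

import Mathlib

noncomputable section

namespace LocalRupert

/-- Euclidean 3-space. -/
abbrev E3 : Type := EuclideanSpace ℝ (Fin 3)

/-- The Euclidean plane, identified with the `xy`-plane of `E3` through `embed`. -/
abbrev E2 : Type := EuclideanSpace ℝ (Fin 2)

/-- The rotation group `SO(3)`. -/
abbrev SO3 : Type := Matrix.specialOrthogonalGroup (Fin 3) ℝ

/-- The inclusion of the plane as `{(x, y, 0)}`. -/
def embed (p : E2) : E3 := !₂[p 0, p 1, 0]

/-- The orthogonal projection to the `xy`-plane, with values in the plane `E2`, so that the
interior of a projection is its interior as a subset of the plane. -/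
def proj (x : E3) : E2 := !₂[x 0, x 1]

/-! ### Rotations and rigid motions -/

/-- The action of `SO(3)` on `E3`. -/
def rotate (ρ : SO3) (x : E3) : E3 :=
  WithLp.toLp 2 (Matrix.mulVec (ρ : Matrix (Fin 3) (Fin 3) ℝ) x.ofLp)

/-- The rigid motion `x ↦ g x + t`. -/
def rigid (g : SO3) (t : E3) (x : E3) : E3 := rotate g x + t

/-- The size `|ρ|` of a rotation: its angle, in `[0, π]`. A rotation by the angle `θ` has trace
`1 + 2 cos θ`; see `rotationSize_eq_abs` for the axis-angle description. -/
def rotationSize (ρ : SO3) : ℝ :=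
  Real.arccos ((Matrix.trace (ρ : Matrix (Fin 3) (Fin 3) ℝ) - 1) / 2)

/-- If `ρ` is the rotation by `θ` about the unit vector `a` (right-hand rule) and `|θ| < π`,
then `|ρ| = |θ|`. -/
theorem rotationSize_eq_abs (ρ : SO3) (a : E3) (θ : ℝ) (ha : ‖a‖ = 1) (hθ : |θ| < Real.pi)
    (h : ∀ x : E3, rotate ρ x = Real.cos θ • x
      + Real.sin θ • (WithLp.toLp 2 (crossProduct a.ofLp x.ofLp) : E3)
      + ((1 - Real.cos θ) * inner ℝ a x) • a) :
    rotationSize ρ = |θ| := by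
  have hn : a 0 ^ 2 + a 1 ^ 2 + a 2 ^ 2 = 1 := by
    have h2 : ‖a‖ ^ 2 = 1 := by rw [ha]; norm_num
    rw [EuclideanSpace.norm_sq_eq] at h2
    simpa [Fin.sum_univ_three, sq_abs] using h2
  have h0 := congrArg (fun y : E3 => y 0) (h (EuclideanSpace.single 0 1))
  have h1 := congrArg (fun y : E3 => y 1) (h (EuclideanSpace.single 1 1))
  have h2 := congrArg (fun y : E3 => y 2) (h (EuclideanSpace.single 2 1))
  simp [rotate, cross_apply, PiLp.inner_apply] at h0 h1 h2
  have ht : (Matrix.trace (ρ : Matrix (Fin 3) (Fin 3) ℝ) - 1) / 2 = Real.cos θ := by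
    rw [Matrix.trace_fin_three, h0, h1, h2]
    linear_combination (1 - Real.cos θ) / 2 * hn
  rw [rotationSize, ht, ← Real.cos_abs, Real.arccos_cos (abs_nonneg θ) hθ.le]

/-! ### Polyhedra, Rupert and reverse Rupert rotations -/

/-- A convex polyhedron: the convex hull of a finite set of points. -/
def IsPolyhedron (Q : Set E3) : Prop := ∃ V : Finset E3, Q = convexHull ℝ (V : Set E3)

/-- `π(ρ(Q)) ⊆ int π(Q)`. -/
def IsRupertRotation (ρ : SO3) (Q : Set E3) : Prop :=
  proj '' (rotate ρ '' Q) ⊆ interior (proj '' Q)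

/-- `π(Q) ⊆ int π(ρ(Q))`. -/
def IsReverseRupertRotation (ρ : SO3) (Q : Set E3) : Prop :=
  proj '' Q ⊆ interior (proj '' (rotate ρ '' Q))

/-- Locally Rupert, for an oriented polyhedron. -/
def OrientedLocallyRupert (Q : Set E3) : Prop :=
  ∀ ε : ℝ, 0 < ε → ∃ ρ : SO3, rotationSize ρ < ε ∧ IsRupertRotation ρ Q

/-- Locally reverse Rupert, for an oriented polyhedron. -/
def OrientedLocallyReverseRupert (Q : Set E3) : Prop :=
  ∀ ε : ℝ, 0 < ε → ∃ ρ : SO3, rotationSize ρ < ε ∧ IsReverseRupertRotation ρ Q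

/-- The unoriented polyhedron represented by `Q` is locally Rupert: some congruent copy is. -/
def LocallyRupert (Q : Set E3) : Prop :=
  ∃ (g : SO3) (t : E3), OrientedLocallyRupert (rigid g t '' Q)

/-- The unoriented polyhedron represented by `Q` is locally reverse Rupert: some congruent copy
is. -/
def LocallyReverseRupert (Q : Set E3) : Prop :=
  ∃ (g : SO3) (t : E3), OrientedLocallyReverseRupert (rigid g t '' Q)

/-! ### Polygons -/

/-- `P` is a regular `n`-gon (a filled polygon) with centre `o`. -/
def IsRegularPolygon (n : ℕ) (o : E2) (P : Set E2) : Prop :=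
  3 ≤ n ∧ ∃ s φ : ℝ, 0 < s ∧
    P = convexHull ℝ (Set.range fun k : Fin n =>
      o + s • (!₂[Real.cos (φ + 2 * Real.pi * (k : ℕ) / n),
        Real.sin (φ + 2 * Real.pi * (k : ℕ) / n)] : E2))

/-- `A` is a nontrivial polygonal arch with endpoints `(a, 0)` and `(b, 0)`, where `a < b`. -/
def IsNontrivialArch (a b : ℝ) (A : Set E2) : Prop :=
  ∃ W : Finset E2, W.Nonempty ∧ (∀ w ∈ W, 0 < w 1 ∧ a < w 0 ∧ w 0 < b) ∧
    A = convexHull ℝ ({!₂[a, 0], !₂[b, 0]} ∪ (W : Set E2))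

/-- Reflection of the plane in the `x`-axis. -/
def flip (p : E2) : E2 := !₂[p 0, -p 1]

/-- `P` is, up to a congruence of the plane, two nontrivial arches with common endpoints on the
`x`-axis, the second one flipped, glued along the segment between the endpoints. -/
def IsNontrivialDoubleArch (P : Set E2) : Prop :=
  ∃ (e : E2 ≃ᵃⁱ[ℝ] E2) (a b : ℝ) (A A' : Set E2), a < b ∧
    IsNontrivialArch a b A ∧ IsNontrivialArch a b A' ∧ e '' P = A ∪ flip '' A'

/-! ### Polygonal sections and prism sections of oriented polyhedra -/

/-- The flat polygon `P` is a polygonal section of `Q`. -/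
def IsPolygonalSection (Q : Set E3) (P : Set E2) : Prop :=
  Q ∩ {x : E3 | x 2 = 0} = embed '' P ∧
    proj ⁻¹' (frontier P) ∩ Q = embed '' (frontier P)

/-- `R` is a prism over `P`. -/
def IsPrismOver (P : Set E2) (R : Set E3) : Prop :=
  ∃ h : ℝ, 0 < h ∧ R = {x : E3 | proj x ∈ P ∧ -h ≤ x 2 ∧ x 2 ≤ h}

/-- `R` is a prism section of `Q` over the polygon `P`. -/
def IsPrismSection (Q : Set E3) (P : Set E2) (R : Set E3) : Prop :=
  IsPrismOver P R ∧ ∃ h : ℝ, 0 < h ∧ R = Q ∩ {x : E3 | -h ≤ x 2 ∧ x 2 ≤ h}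

/-- Some congruent copy of `Q` has a polygonal section which is a regular `n`-gon, is nontrivial
double-arch, and has its centre at the image of the point `c`. -/
def HasRegularArchSection (n : ℕ) (c : E3) (Q : Set E3) : Prop :=
  ∃ (g : SO3) (t : E3) (o : E2) (P : Set E2), rigid g t c = embed o ∧
    IsRegularPolygon n o P ∧ IsNontrivialDoubleArch P ∧ IsPolygonalSection (rigid g t '' Q) P

/-- Some congruent copy of `Q` has a prism section over a polygon which is a regular `n`-gon, is
nontrivial double-arch, and has its centre at the image of the point `c`. -/
def HasRegularArchPrismSection (n : ℕ) (c : E3) (Q : Set E3) : Prop :=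
  ∃ (g : SO3) (t : E3) (o : E2) (P : Set E2) (R : Set E3), rigid g t c = embed o ∧
    IsRegularPolygon n o P ∧ IsNontrivialDoubleArch P ∧ IsPrismSection (rigid g t '' Q) P R

/-! ### Duality -/

/-- The dual of `Q` by reciprocation in the sphere with centre `c` and radius `r`. -/
def dual (c : E3) (r : ℝ) (Q : Set E3) : Set E3 :=
  {y : E3 | ∀ x ∈ Q, inner ℝ (x - c) (y - c) ≤ r ^ 2}

end LocalRupert

end

/-!
# Regular polygonal sections, duality and local Rupertness

After a rigid motion the centre of the sphere of reciprocation is a point `o` of the `xy`-plane,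
and reciprocation commutes with rigid motions (`rigid_image_dual`).

Equivalence of the two conditions. If `P` is a polygonal section of `Q`, then `Q` projects
into `P`, and each vertex of `Q` lies either in the section plane or over the interior of `P`
(`IsPolygonalSection.proj_mem`, `IsPolygonalSection.interior_or`). The vertices of the first kind
confine the dual to the vertical cylinder over the reciprocal `polar o r P`. The constraints of the
others are slack on it at height `0`, hence redundant at small heights, so the dual has a prism
section over `polar o r P` (`IsPolygonalSection.dual_prismSection`). Conversely, if the dual has a
prism section over `P`, then it projects into `P`. A point of `Q` over the boundary of
`polar o r P` is tight for some `y` in `P`, and since `(y, ±δ)` lies in the dual its height is `0`.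
That the section is all of `polar o r P` is a separation argument
(`IsPrismSection.polygonalSection`). The reciprocal of a regular polygon in a concentric circle is
its image under a similarity (`polar_vertices`), so it is again a regular nontrivial double arch
(`IsRegularPolygon.polar_doubleArch`).

Rupert rotations. Centre the chord of the double arch on the `x`-axis; this is done by a
congruence of the plane, which lifts to a rigid motion of space (`exists_rigid_lift`). A small
rotation about the chord brings the projections of all vertices into the interior of `P`, except
for the two endpoints of the chord, and a much smaller rotation about the `y`-axis shortens the
chord (`IsCentredDoubleArch.orientedLocallyRupert`).

Reverse Rupert rotations. For a prism section, a small rotation about the chord makes the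
projection contain `P` without the endpoints in its interior, while the vertical edges over the
endpoints become segments perpendicular to the chord. A much smaller rotation about the `z`-axis
then brings the endpoints into the interior as well: it tilts the strip spanned by these
segments, without changing its width, so that the strip cuts the `x`-axis in a longer segment
(`IsCentredDoubleArch.orientedLocallyReverseRupert`).
-/

noncomputable section

namespace LocalRupert

open Set Filter Topology

/-! ### Coordinates, rotations and rigid motions -/

@[simp] lemma embed_zero (p : E2) : embed p 0 = p 0 := rfl
@[simp] lemma embed_one (p : E2) : embed p 1 = p 1 := rfl
@[simp] lemma embed_two (p : E2) : embed p 2 = 0 := rfl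
@[simp] lemma proj_zero (x : E3) : proj x 0 = x 0 := rfl
@[simp] lemma proj_one (x : E3) : proj x 1 = x 1 := rfl

lemma ext_E2 {p q : E2} (h0 : p 0 = q 0) (h1 : p 1 = q 1) : p = q := by
  ext i; fin_cases i <;> assumption

lemma ext_E3 {x y : E3} (h0 : x 0 = y 0) (h1 : x 1 = y 1) (h2 : x 2 = y 2) : x = y := by
  ext i; fin_cases i <;> assumption

@[simp] lemma proj_embed (p : E2) : proj (embed p) = p := ext_E2 rfl rfl

lemma eq_embed_proj {x : E3} (h : x 2 = 0) : x = embed (proj x) := ext_E3 rfl rfl h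

/-- The projection `proj` as a linear map. -/
def projₗ : E3 →ₗ[ℝ] E2 where
  toFun := proj
  map_add' _ _ := ext_E2 rfl rfl
  map_smul' _ _ := ext_E2 rfl rfl

/-- The inclusion `embed` as a linear map. -/
def embedₗ : E2 →ₗ[ℝ] E3 where
  toFun := embed
  map_add' x y := ext_E3 rfl rfl (by simp)
  map_smul' a x := ext_E3 rfl rfl (by simp)

lemma continuous_proj : Continuous proj := projₗ.continuous_of_finiteDimensional

lemma continuous_embed : Continuous embed := embedₗ.continuous_of_finiteDimensional

lemma inner_E2 (p q : E2) : inner ℝ p q = p 0 * q 0 + p 1 * q 1 := by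
  simp [PiLp.inner_apply, Fin.sum_univ_two, mul_comm]

lemma inner_E3 (p q : E3) : inner ℝ p q = p 0 * q 0 + p 1 * q 1 + p 2 * q 2 := by
  simp [PiLp.inner_apply, Fin.sum_univ_three, mul_comm]

lemma inner_sub_embed (o : E2) (x y : E3) :
    inner ℝ (x - embed o) (y - embed o) = inner ℝ (proj x - o) (proj y - o) + x 2 * y 2 := by
  simp [inner_E2, inner_E3]

lemma rotate_apply (ρ : SO3) (x : E3) (i : Fin 3) :
    rotate ρ x i = ρ.1 i 0 * x 0 + ρ.1 i 1 * x 1 + ρ.1 i 2 * x 2 := by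
  simp [rotate, Matrix.mulVec, dotProduct, Fin.sum_univ_three]

lemma rotate_mul (ρ σ : SO3) (x : E3) : rotate (ρ * σ) x = rotate ρ (rotate σ x) := by
  simp [rotate, Matrix.mulVec_mulVec]

lemma rotate_one (x : E3) : rotate 1 x = x := by simp [rotate]

/-- A rotation as a linear map. -/
def rotateₗ (ρ : SO3) : E3 →ₗ[ℝ] E3 where
  toFun := rotate ρ
  map_add' x y := by simp [rotate, Matrix.mulVec_add]
  map_smul' a x := by simp [rotate, Matrix.mulVec_smul]

lemma inner_rotate (ρ : SO3) (x y : E3) : inner ℝ (rotate ρ x) (rotate ρ y) = inner ℝ x y := by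
  have h := (Matrix.mem_orthogonalGroup_iff' (Fin 3) ℝ).1
    (Matrix.mem_specialOrthogonalGroup_iff.1 ρ.2).1
  have h' (i j : Fin 3) := congrFun (congrFun h i) j
  simp only [Matrix.mul_apply, Fin.sum_univ_three] at h'
  have h00 := h' 0 0
  have h01 := h' 0 1
  have h02 := h' 0 2
  have h11 := h' 1 1
  have h12 := h' 1 2
  have h22 := h' 2 2
  simp at h00 h01 h02 h11 h12 h22
  simp only [inner_E3, rotate_apply]
  linear_combination (x 0 * y 0) * h00 + (x 0 * y 1 + x 1 * y 0) * h01
    + (x 0 * y 2 + x 2 * y 0) * h02 + (x 1 * y 1) * h11 + (x 1 * y 2 + x 2 * y 1) * h12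
    + (x 2 * y 2) * h22

/-- A rigid motion as an affine isometry. -/
def rigidEquiv (g : SO3) (t : E3) : E3 ≃ᵃⁱ[ℝ] E3 :=
  (LinearIsometryEquiv.toAffineIsometryEquiv
    { rotateₗ g with
      invFun := rotate g⁻¹
      left_inv := fun x => by
        change rotate g⁻¹ (rotate g x) = x
        rw [← rotate_mul, inv_mul_cancel, rotate_one]
      right_inv := fun x => by
        change rotate g (rotate g⁻¹ x) = x
        rw [← rotate_mul, mul_inv_cancel, rotate_one]
      norm_map' := fun x => by
        change ‖rotate g x‖ = ‖x‖
        rw [norm_eq_sqrt_real_inner, norm_eq_sqrt_real_inner (x := x), inner_rotate] }).trans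
    (AffineIsometryEquiv.constVAdd ℝ E3 t)

lemma coe_rigidEquiv (g : SO3) (t : E3) : ⇑(rigidEquiv g t) = rigid g t := by
  funext x
  change t + rotate g x = rotate g x + t
  exact add_comm _ _

lemma rigid_sub (g : SO3) (t x y : E3) : rigid g t x - rigid g t y = rotate g (x - y) := by
  have h := (rotateₗ g).map_sub x y
  change rotate g (x - y) = rotate g x - rotate g y at h
  rw [h]
  simp [rigid]

lemma rigid_rigid (g g' : SO3) (t t' x : E3) :
    rigid g' t' (rigid g t x) = rigid (g' * g) (rotate g' t + t') x := by
  have h := (rotateₗ g').map_add (rotate g x) t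
  change rotate g' (rotate g x + t) = rotate g' (rotate g x) + rotate g' t at h
  rw [rigid, rigid, h, rigid, rotate_mul, add_assoc]

lemma rigid_image_convexHull (g : SO3) (t : E3) (s : Set E3) :
    rigid g t '' convexHull ℝ s = convexHull ℝ (rigid g t '' s) := by
  rw [← coe_rigidEquiv]
  exact (rigidEquiv g t).toAffineEquiv.toAffineMap.image_convexHull s

lemma rigid_image_interior (g : SO3) (t : E3) (s : Set E3) :
    rigid g t '' interior s = interior (rigid g t '' s) := by
  rw [← coe_rigidEquiv]
  exact (rigidEquiv g t).toHomeomorph.image_interior s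

lemma IsPolyhedron.rigid_image {Q : Set E3} (hQ : IsPolyhedron Q) (g : SO3) (t : E3) :
    IsPolyhedron (rigid g t '' Q) := by
  classical
  obtain ⟨V, rfl⟩ := hQ
  exact ⟨V.image (rigid g t), by rw [rigid_image_convexHull, Finset.coe_image]⟩

/-- Reciprocation commutes with rigid motions. -/
lemma rigid_image_dual (g : SO3) (t c : E3) (r : ℝ) (Q : Set E3) :
    rigid g t '' dual c r Q = dual (rigid g t c) r (rigid g t '' Q) := by
  ext y
  constructor
  · rintro ⟨y, hy, rfl⟩ _ ⟨x, hx, rfl⟩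
    rw [rigid_sub, rigid_sub, inner_rotate]
    exact hy x hx
  · intro hy
    obtain ⟨z, rfl⟩ : ∃ z, rigid g t z = y := by
      rw [← coe_rigidEquiv]; exact (rigidEquiv g t).surjective y
    refine ⟨z, fun x hx => ?_, rfl⟩
    have := hy _ ⟨x, hx, rfl⟩
    rwa [rigid_sub, rigid_sub, inner_rotate] at this

lemma mem_SO3_of_columns (M : Matrix (Fin 3) (Fin 3) ℝ) (h : M.transpose * M = 1)
    (hd : M.det = 1) : M ∈ Matrix.specialOrthogonalGroup (Fin 3) ℝ :=
  Matrix.mem_specialOrthogonalGroup_iff.2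
    ⟨(Matrix.mem_orthogonalGroup_iff' (Fin 3) ℝ).2 h, hd⟩

/-- Every congruence of the plane is induced by a rigid motion of space; a congruence that
reverses the orientation is lifted by letting the motion reverse the `z`-axis. -/
lemma exists_rigid_lift (e : E2 ≃ᵃⁱ[ℝ] E2) :
    ∃ (g : SO3) (t : E3) (d : ℝ), d ^ 2 = 1 ∧
      ∀ x, proj (rigid g t x) = e (proj x) ∧ rigid g t x 2 = d * x 2 := by
  set L := e.linearIsometryEquiv
  set u := L (EuclideanSpace.single 0 1) with hu
  set v := L (EuclideanSpace.single 1 1) with hv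
  have huu : u 0 * u 0 + u 1 * u 1 = 1 := by
    rw [← inner_E2, hu, L.inner_map_map]; simp
  have hvv : v 0 * v 0 + v 1 * v 1 = 1 := by
    rw [← inner_E2, hv, L.inner_map_map]; simp
  have huv : u 0 * v 0 + u 1 * v 1 = 0 := by
    rw [← inner_E2, hu, hv, L.inner_map_map, inner_E2]; simp
  have hL (p : E2) : e p = p 0 • u + p 1 • v + e 0 := by
    have h1 : e p = L p + e 0 := by
      have := e.map_vadd 0 p
      simpa using this
    have h2 : p = p 0 • (EuclideanSpace.single 0 1 : E2) + p 1 • EuclideanSpace.single 1 1 :=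
      ext_E2 (by simp) (by simp)
    rw [h1, hu, hv, ← map_smul, ← map_smul, ← map_add, ← h2]
  set d := u 0 * v 1 - v 0 * u 1
  have hd : d ^ 2 = 1 := by
    simp only [d]
    linear_combination (v 0 * v 0 + v 1 * v 1) * huu + hvv - (u 0 * v 0 + u 1 * v 1) * huv
  refine ⟨⟨!![u 0, v 0, 0; u 1, v 1, 0; 0, 0, d], mem_SO3_of_columns _ ?_ ?_⟩, embed (e 0), d, hd,
    fun x => ⟨?_, ?_⟩⟩
  · ext i j
    fin_cases i <;> fin_cases j <;>
      simp [Matrix.mul_apply, Fin.sum_univ_three] <;> linarith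
  · rw [Matrix.det_fin_three]
    simp
    linear_combination hd
  · rw [hL (proj x)]
    apply ext_E2 <;> simp [rigid, rotate_apply] <;> ring
  · simp [rigid, rotate_apply]

/-! ### Sections, projections and duality -/

/-- The reciprocal of a planar set in the circle with centre `o` and radius `r`. -/
def polar (o : E2) (r : ℝ) (P : Set E2) : Set E2 :=
  {y : E2 | ∀ x ∈ P, inner ℝ (x - o) (y - o) ≤ r ^ 2}

lemma polar_convexHull (o : E2) (r : ℝ) (s : Set E2) :
    polar o r (convexHull ℝ s) = {y | ∀ x ∈ s, inner ℝ (x - o) (y - o) ≤ r ^ 2} := by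
  ext y
  refine ⟨fun h x hx => h x (subset_convexHull ℝ s hx), fun h => ?_⟩
  have hc : Convex ℝ {x : E2 | inner ℝ (x - o) (y - o) ≤ r ^ 2} := by
    have := convex_halfSpace_le (𝕜 := ℝ) (f := fun x : E2 => inner ℝ x (y - o))
      ⟨fun a b => inner_add_left _ _ _, fun a b => real_inner_smul_left _ _ _⟩
      (r ^ 2 + inner ℝ o (y - o))
    simpa [inner_sub_left] using this
  exact fun x hx => convexHull_min h hc hx

lemma dual_convexHull (c : E3) (r : ℝ) (s : Set E3) :
    dual c r (convexHull ℝ s) = {y | ∀ x ∈ s, inner ℝ (x - c) (y - c) ≤ r ^ 2} := by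
  ext y
  refine ⟨fun h x hx => h x (subset_convexHull ℝ s hx), fun h => ?_⟩
  have hc : Convex ℝ {x : E3 | inner ℝ (x - c) (y - c) ≤ r ^ 2} := by
    have := convex_halfSpace_le (𝕜 := ℝ) (f := fun x : E3 => inner ℝ x (y - c))
      ⟨fun a b => inner_add_left _ _ _, fun a b => real_inner_smul_left _ _ _⟩
      (r ^ 2 + inner ℝ c (y - c))
    simpa [inner_sub_left] using this
  exact fun x hx => convexHull_min h hc hx

lemma isClosed_polar (o : E2) (r : ℝ) (P : Set E2) : IsClosed (polar o r P) := by
  have : polar o r P = ⋂ x ∈ P, {y | inner ℝ (x - o) (y - o) ≤ r ^ 2} := by ext; simp [polar]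
  rw [this]
  exact isClosed_biInter fun x _ => isClosed_le (by fun_prop) continuous_const

lemma convex_polar (o : E2) (r : ℝ) (P : Set E2) : Convex ℝ (polar o r P) := by
  have : polar o r P = ⋂ x ∈ P, {y | inner ℝ (x - o) y ≤ r ^ 2 + inner ℝ (x - o) o} := by
    ext; simp [polar, inner_sub_right]
  rw [this]
  exact convex_iInter₂ fun x _ => convex_halfSpace_le
    ⟨fun a b => inner_add_right _ _ _, fun a b => real_inner_smul_right _ _ _⟩ _

lemma convex_dual (c : E3) (r : ℝ) (Q : Set E3) : Convex ℝ (dual c r Q) := by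
  have : dual c r Q = ⋂ x ∈ Q, {y | inner ℝ (x - c) y ≤ r ^ 2 + inner ℝ (x - c) c} := by
    ext; simp [dual, inner_sub_right]
  rw [this]
  exact convex_iInter₂ fun x _ => convex_halfSpace_le
    ⟨fun a b => inner_add_right _ _ _, fun a b => real_inner_smul_right _ _ _⟩ _

/-- A polyhedron with a polygonal section projects into that section: otherwise a segment from
the centre to a point outside would cross the cylinder over the boundary off the section plane. -/
lemma IsPolygonalSection.proj_mem {Q : Set E3} {P : Set E2} {o : E2} (hQ : Convex ℝ Q)
    (ho : embed o ∈ interior Q) (h : IsPolygonalSection Q P) {q : E3} (hq : q ∈ Q) :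
    proj q ∈ P := by
  have hP (p : E2) : embed p ∈ Q ↔ p ∈ P := by
    have := Set.ext_iff.1 h.1 (embed p)
    simp only [mem_inter_iff, mem_ofPred_eq, embed_two, and_true] at this
    rw [this]
    exact ⟨fun ⟨p', hp', e⟩ => by rw [← proj_embed p, ← e, proj_embed]; exact hp',
      fun hp => ⟨p, hp, rfl⟩⟩
  have hoP : o ∈ interior P := by
    refine mem_interior.2 ⟨embed ⁻¹' interior Q, fun p hp => (hP p).1 (interior_subset hp),
      isOpen_interior.preimage continuous_embed, ho⟩
  by_contra hqP
  obtain ⟨x, hx, hxf⟩ : ∃ x ∈ segment ℝ (embed o) q, proj x ∈ frontier P := by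
    by_contra! hno
    obtain ⟨_, ⟨x, -, rfl⟩, h1, h2⟩ :=
      ((convex_segment (𝕜 := ℝ) (embed o) q).isPreconnected.image proj
        continuous_proj.continuousOn) (interior P) (closure P)ᶜ isOpen_interior
        isClosed_closure.isOpen_compl
        (by
          rintro _ ⟨x, hx, rfl⟩
          by_contra hx'
          simp only [mem_union, mem_compl_iff, not_or, not_not] at hx'
          exact hno x hx ⟨hx'.2, hx'.1⟩)
        ⟨o, ⟨embed o, left_mem_segment _ _ _, proj_embed o⟩, hoP⟩
        ⟨proj q, ⟨q, right_mem_segment _ _ _, rfl⟩, fun hc =>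
          hno q (right_mem_segment _ _ _) ⟨hc, fun hi => hqP (interior_subset hi)⟩⟩
    exact h2 (subset_closure (interior_subset h1))
  have hxQ : x ∈ Q := hQ.segment_subset (interior_subset ho) hq hx
  have hxe : x ∈ embed '' frontier P := h.2 ▸ ⟨hxf, hxQ⟩
  obtain ⟨p, hp, rfl⟩ := hxe
  obtain ⟨a, b, ha, hb, hab, e⟩ := hx
  have e2 := congrArg (fun y : E3 => y 2) e
  simp at e2
  rcases e2 with rfl | e2
  · have : embed p = embed o := by rw [← e]; simp [show a = 1 by linarith]
    have : p = o := by rw [← proj_embed p, this, proj_embed]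
    exact hp.2 (this ▸ hoP)
  · exact hqP ((hP _).1 (eq_embed_proj e2 ▸ hq))

/-- A point over the boundary of a polygonal section lies in the section plane. -/
lemma IsPolygonalSection.interior_or {Q : Set E3} {P : Set E2} {o : E2} (hQ : Convex ℝ Q)
    (ho : embed o ∈ interior Q) (h : IsPolygonalSection Q P) {q : E3} (hq : q ∈ Q) :
    proj q ∈ interior P ∨ q 2 = 0 := by
  by_cases hi : proj q ∈ interior P
  · exact .inl hi
  · have hf : q ∈ proj ⁻¹' frontier P ∩ Q :=
      ⟨⟨subset_closure (h.proj_mem hQ ho hq), hi⟩, hq⟩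
    rw [h.2] at hf
    obtain ⟨p, -, rfl⟩ := hf
    exact .inr rfl

lemma IsPolygonalSection.embed_mem {Q : Set E3} {P : Set E2} (h : IsPolygonalSection Q P)
    {p : E2} (hp : p ∈ P) : embed p ∈ Q :=
  (h.1.symm ▸ mem_image_of_mem embed hp : embed p ∈ Q ∩ {x : E3 | x 2 = 0}).1

/-- Near its equator, the dual is cut out by the vertices in the section plane alone: the
constraint of a vertex over the interior of `P` is slack on `polar o r P`. -/
lemma IsPolygonalSection.dual_prismSection {Q : Set E3} {P : Set E2} {o : E2} {r : ℝ}
    (hr : 0 < r) (hQ : IsPolyhedron Q) (ho : embed o ∈ interior Q) (h : IsPolygonalSection Q P) :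
    ∃ R, IsPrismSection (dual (embed o) r Q) (polar o r P) R := by
  have hconv : Convex ℝ Q := by obtain ⟨V, rfl⟩ := hQ; exact convex_convexHull ℝ _
  have hsub {y : E3} (hy : y ∈ dual (embed o) r Q) : proj y ∈ polar o r P := fun p hp => by
    have := hy _ (h.embed_mem hp)
    simpa [inner_sub_embed] using this
  obtain ⟨V, hV⟩ := hQ
  have key : ∀ v ∈ V, ∀ᶠ δ in 𝓝[>] (0 : ℝ), ∀ y : E3, proj y ∈ polar o r P → |y 2| ≤ δ →
      inner ℝ (v - embed o) (y - embed o) ≤ r ^ 2 := by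
    intro v hv
    have hvQ : v ∈ Q := by rw [hV]; exact subset_convexHull ℝ _ hv
    rcases h.interior_or hconv ho hvQ with hi | h0
    · have hcont : Continuous fun τ : ℝ => o + τ • (proj v - o) := by fun_prop
      have hev : ∀ᶠ τ in 𝓝[>] (1 : ℝ), o + τ • (proj v - o) ∈ interior P :=
        (hcont.continuousAt.eventually
          (isOpen_interior.eventually_mem (by simpa using hi))).filter_mono nhdsWithin_le_nhds
      obtain ⟨τ, hτ, hτ1⟩ := (hev.and self_mem_nhdsWithin).exists
      have hτ1 : 1 < τ := hτ1
      have hlim : Tendsto (fun δ : ℝ => |v 2| * δ) (𝓝[>] 0) (𝓝 0) := by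
        have : Continuous fun δ : ℝ => |v 2| * δ := by fun_prop
        exact (this.tendsto' 0 0 (by simp)).mono_left nhdsWithin_le_nhds
      have hpos : 0 < r ^ 2 - r ^ 2 / τ := by
        rw [sub_pos, div_lt_iff₀ (by linarith)]
        nlinarith [pow_pos hr 2]
      filter_upwards [hlim.eventually (gt_mem_nhds hpos)] with δ hδ y hy hyδ
      have h1 := hy _ (interior_subset hτ)
      rw [add_sub_cancel_left, real_inner_smul_left, mul_comm, ← le_div_iff₀ (by linarith)] at h1
      have h2 : v 2 * y 2 ≤ |v 2| * δ :=
        (le_abs_self _).trans (by rw [abs_mul]; gcongr)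
      rw [inner_sub_embed]
      linarith
    · refine Eventually.of_forall fun δ y hy _ => ?_
      have := hy _ (h.proj_mem hconv ho hvQ)
      simpa [inner_sub_embed, h0] using this
  obtain ⟨δ, hδ, hδ0⟩ := (((Finset.eventually_all V).2 key).and self_mem_nhdsWithin).exists
  refine ⟨_, ⟨δ, hδ0, rfl⟩, δ, hδ0, ?_⟩
  ext y
  constructor
  · rintro ⟨h1, h2, h3⟩
    refine ⟨?_, h2, h3⟩
    rw [hV, dual_convexHull]
    exact fun v hv => hδ v hv y h1 (abs_le.2 ⟨h2, h3⟩)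
  · rintro ⟨h1, h2, h3⟩
    exact ⟨hsub h1, h2, h3⟩

/-- Within a thin slab, membership in a set with a prism section depends on the projection
only. -/
lemma IsPrismSection.exists_slab {D R : Set E3} {P : Set E2} (h : IsPrismSection D P R) :
    ∃ δ : ℝ, 0 < δ ∧ ∀ y : E3, |y 2| ≤ δ → (y ∈ D ↔ proj y ∈ P) := by
  obtain ⟨⟨h', hh', e'⟩, h, hh, e⟩ := h
  refine ⟨min h h', lt_min hh hh', fun y hy => ?_⟩
  obtain ⟨h1, h2⟩ := abs_le.1 (hy.trans (min_le_left _ _))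
  obtain ⟨h3, h4⟩ := abs_le.1 (hy.trans (min_le_right _ _))
  have := Set.ext_iff.1 (e.symm.trans e') y
  simpa [h1, h2, h3, h4] using this

/-- A convex set with a prism section over `P` projects into `P`: moving from a closest point
of `P` slightly towards a point of the set stays inside the slab, hence over `P`. -/
lemma IsPrismSection.proj_mem {D R : Set E3} {P : Set E2} (hD : Convex ℝ D) (hP : IsCompact P)
    (hne : P.Nonempty) (h : IsPrismSection D P R) {y : E3} (hy : y ∈ D) : proj y ∈ P := by
  obtain ⟨δ, hδ, hslab⟩ := h.exists_slab
  obtain ⟨p, hp, hmin⟩ := hP.exists_infDist_eq_dist hne (proj y)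
  have hpD : embed p ∈ D := (hslab _ (by simpa using hδ.le)).2 (by simpa using hp)
  obtain ⟨ε, hε0, hε1, hε⟩ : ∃ ε : ℝ, 0 < ε ∧ ε ≤ 1 ∧ ε * |y 2| ≤ δ := by
    refine ⟨min 1 (δ / (|y 2| + 1)), by positivity, min_le_left _ _, ?_⟩
    calc min 1 (δ / (|y 2| + 1)) * |y 2| ≤ δ / (|y 2| + 1) * (|y 2| + 1) := by
          gcongr
          · exact min_le_right _ _
          · linarith
      _ = δ := by field_simp
  have hm : (1 - ε) • embed p + ε • y ∈ D := hD hpD hy (by linarith) hε0.le (by ring)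
  have hmP := (hslab _ (by simpa [abs_mul, abs_of_pos hε0] using hε)).1 hm
  have hle := Metric.infDist_le_dist_of_mem (x := proj y) hmP
  have heq : proj y - proj ((1 - ε) • embed p + ε • y) = (1 - ε) • (proj y - p) :=
    ext_E2 (by simp; ring) (by simp; ring)
  rw [hmin, dist_eq_norm, dist_eq_norm, heq, norm_smul, Real.norm_eq_abs,
    abs_of_nonneg (by linarith)] at hle
  have h0 : ‖proj y - p‖ = 0 := by nlinarith [norm_nonneg (proj y - p)]
  rwa [sub_eq_zero.1 (norm_eq_zero.1 h0)]

/-- The inclusion needed from the bipolar theorem: a point outside a closed convex set containing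
`c` in its interior violates a constraint given by a point of the dual. -/
lemma exists_mem_dual_of_notMem {Q : Set E3} {c x : E3} {r : ℝ} (hr : 0 < r) (hQ : Convex ℝ Q)
    (hcl : IsClosed Q) (hc : c ∈ Q) (hx : x ∉ Q) :
    ∃ y ∈ dual c r Q, r ^ 2 < inner ℝ (x - c) (y - c) := by
  obtain ⟨f, u, hfu, hux⟩ := geometric_hahn_banach_closed_point hQ hcl hx
  have hm : 0 < u - f c := sub_pos.2 (hfu c hc)
  set w := (InnerProductSpace.toDual ℝ E3).symm f
  have hw (z : E3) : inner ℝ z w = f z := by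
    rw [real_inner_comm]; exact InnerProductSpace.toDual_symm_apply
  refine ⟨c + (r ^ 2 / (u - f c)) • w, fun q hq => ?_, ?_⟩
  · rw [add_sub_cancel_left, real_inner_smul_right, hw, map_sub, div_mul_eq_mul_div,
      div_le_iff₀ hm]
    have := hfu q hq
    gcongr
  · rw [add_sub_cancel_left, real_inner_smul_right, hw, map_sub, div_mul_eq_mul_div,
      lt_div_iff₀ hm]
    gcongr

/-- If `(y, ±δ)` belong to the dual for the vertices `y` of `P`, a point of `Q` over the boundary
of `polar o r P` is tight for some such `y`, which forces its height to vanish. -/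
lemma IsPrismSection.polygonalSection {Q R : Set E3} {o : E2} {r : ℝ} {F : Set E2}
    (hF : F.Finite) (hne : F.Nonempty) (hr : 0 < r) (hQ : IsPolyhedron Q)
    (ho : embed o ∈ interior Q)
    (h : IsPrismSection (dual (embed o) r Q) (convexHull ℝ F) R) :
    IsPolygonalSection Q (polar o r (convexHull ℝ F)) := by
  have hconv : Convex ℝ Q := by obtain ⟨V, rfl⟩ := hQ; exact convex_convexHull ℝ _
  have hcl : IsClosed Q := by
    obtain ⟨V, rfl⟩ := hQ; exact V.finite_toSet.isClosed_convexHull (𝕜 := ℝ)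
  obtain ⟨δ, hδ, hslab⟩ := h.exists_slab
  have hQS {q : E3} (hq : q ∈ Q) : proj q ∈ polar o r (convexHull ℝ F) := fun p hp => by
    have := (hslab (embed p) (by simpa using hδ.le)).2 (by simpa using hp) q hq
    rw [inner_sub_embed] at this
    rw [real_inner_comm]
    simpa using this
  have hSQ {p : E2} (hp : p ∈ polar o r (convexHull ℝ F)) : embed p ∈ Q := by
    by_contra hpQ
    obtain ⟨y, hy, hlt⟩ := exists_mem_dual_of_notMem hr hconv hcl (interior_subset ho) hpQ
    have hyP := h.proj_mem (convex_dual _ _ _) (hF.isCompact_convexHull (𝕜 := ℝ)) hne.convexHull hy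
    have := hp _ hyP
    rw [inner_sub_embed, real_inner_comm] at hlt
    simp at hlt
    linarith
  have hfr {q : E3} (hq : q ∈ Q) (hqf : proj q ∈ frontier (polar o r (convexHull ℝ F))) :
      q 2 = 0 := by
    obtain ⟨p, hp, hpq⟩ : ∃ p ∈ F, r ^ 2 ≤ inner ℝ (p - o) (proj q - o) := by
      by_contra! hlt
      refine hqf.2 (mem_interior.2 ⟨⋂ p ∈ F, {z | inner ℝ (p - o) (z - o) < r ^ 2}, ?_, ?_, ?_⟩)
      · intro z hz
        rw [polar_convexHull]
        exact fun p hp => (mem_iInter₂.1 hz p hp).le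
      · exact hF.isOpen_biInter fun p _ => isOpen_lt (by fun_prop) continuous_const
      · exact mem_iInter₂.2 hlt
    have hht (z : ℝ) (hz : |z| ≤ δ) : q 2 * z ≤ 0 := by
      have := (hslab !₂[p 0, p 1, z] (by simpa using hz)).2
        (subset_convexHull ℝ F (by convert hp using 1; exact ext_E2 rfl rfl)) q hq
      rw [inner_sub_embed, show proj !₂[p 0, p 1, z] = p from ext_E2 rfl rfl,
        real_inner_comm] at this
      simp at this
      linarith
    have h1 := hht δ (abs_of_pos hδ).le
    have h2 := hht (-δ) (by rw [abs_neg, abs_of_pos hδ])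
    nlinarith
  constructor
  · ext x
    constructor
    · rintro ⟨hx, hx0⟩
      exact ⟨proj x, hQS hx, (eq_embed_proj hx0).symm⟩
    · rintro ⟨p, hp, rfl⟩
      exact ⟨hSQ hp, rfl⟩
  · ext x
    constructor
    · rintro ⟨hxf, hx⟩
      exact ⟨proj x, hxf, (eq_embed_proj (hfr hx hxf)).symm⟩
    · rintro ⟨p, hp, rfl⟩
      exact ⟨by simpa using hp, hSQ ((isClosed_polar _ _ _).frontier_subset hp)⟩

/-! ### Convex planar sets with a chord -/

/-- A point lying strictly between the base at height `c` and the apex of a triangle, vertically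
below or above the apex, is interior. -/
lemma mem_interior_of_triangle {K : Set E2} (hK : Convex ℝ K) {b c x y y' : ℝ}
    (hl : !₂[-b, c] ∈ K) (hr : !₂[b, c] ∈ K) (ht : !₂[x, y'] ∈ K) (hx : |x| < b)
    (h0 : 0 < (y - c) / (y' - c)) (h1 : (y - c) / (y' - c) < 1) :
    (!₂[x, y] : E2) ∈ interior K := by
  have hb : 0 < b := (abs_nonneg x).trans_lt hx
  have hne : y' - c ≠ 0 := by rintro h; simp [h] at h0
  -- `L p` is the weight of the apex in the barycentric coordinates of `p`
  let L : E2 → ℝ := fun p => (p 1 - c) / (y' - c)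
  have hL : Continuous L := by fun_prop
  refine mem_interior.2 ⟨{p | 0 < L p ∧ L p < 1 ∧ |p 0 - L p * x| < b * (1 - L p)}, ?_, ?_, ?_⟩
  · rintro p ⟨hp0, -, hp2⟩
    obtain ⟨h3, h4⟩ := abs_lt.1 hp2
    have h5 : -(1 - L p) < (p 0 - L p * x) / b := by rw [lt_div_iff₀ hb]; linarith
    have h6 : (p 0 - L p * x) / b < 1 - L p := by rw [div_lt_iff₀ hb]; linarith
    have := hK.sum_mem (t := (Finset.univ : Finset (Fin 3)))
      (w := ![L p, ((1 - L p) + (p 0 - L p * x) / b) / 2, ((1 - L p) - (p 0 - L p * x) / b) / 2])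
      (z := ![!₂[x, y'], !₂[b, c], !₂[-b, c]])
      (by intro i _; fin_cases i <;> simp <;> linarith)
      (by simp [Fin.sum_univ_three]; ring)
      (by intro i _; fin_cases i <;> simp [*])
    convert this using 1
    apply ext_E2 <;> simp [Fin.sum_univ_three]
    · field_simp; ring
    · simp only [L]; field_simp; ring
  · have hR : IsOpen {p : E2 | |p 0 - L p * x| < b * (1 - L p)} :=
      isOpen_lt (by fun_prop) (by fun_prop)
    exact (isOpen_lt continuous_const hL).inter ((isOpen_lt hL continuous_const).inter hR)
  · have e : x - (y - c) / (y' - c) * x = x * (1 - (y - c) / (y' - c)) := by ring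
    refine ⟨h0, h1, ?_⟩
    change |x - (y - c) / (y' - c) * x| < b * (1 - (y - c) / (y' - c))
    rw [e, abs_mul, abs_of_pos (sub_pos.2 h1)]
    exact mul_lt_mul_of_pos_right hx (sub_pos.2 h1)

/-- The shape of a nontrivial double arch after centring its chord at the origin: the chord is
`[-b, b] × {0}`, its endpoints are the only points of `P` outside the open strip over it, and
`P` has points of the open strip strictly above and strictly below the chord. -/
structure IsCentredDoubleArch (b : ℝ) (P : Set E2) : Prop where
  pos : 0 < b
  left_mem : !₂[-b, 0] ∈ P
  right_mem : !₂[b, 0] ∈ P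
  exists_above : ∃ u ∈ P, |u 0| < b ∧ 0 < u 1
  exists_below : ∃ u ∈ P, |u 0| < b ∧ u 1 < 0
  strip : ∀ p ∈ P, |p 0| < b ∨ p = !₂[-b, 0] ∨ p = !₂[b, 0]

lemma E2_eta (p : E2) : !₂[p 0, p 1] = p := ext_E2 rfl rfl

/-- Vertically off each point of the open chord, on the side of the apex `u`, there is an interior
point. -/
lemma exists_mem_interior_of_apex {P : Set E2} (hP : Convex ℝ P) {b x : ℝ}
    (hl : !₂[-b, 0] ∈ P) (hr : !₂[b, 0] ∈ P) {u : E2} (hu : u ∈ P) (hub : |u 0| < b)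
    (hu1 : u 1 ≠ 0) (hx : |x| < b) : ∃ y, 0 < y / u 1 ∧ !₂[x, y] ∈ interior P := by
  have hb : 0 < b := (abs_nonneg x).trans_lt hx
  obtain ⟨hx0, hx1⟩ := abs_lt.1 hx
  obtain ⟨hu2, hu3⟩ := abs_lt.1 hub
  obtain ⟨τ, hτ0, hτ⟩ : ∃ τ : ℝ, 0 < τ ∧ !₂[x, τ * u 1] ∈ P := by
    rcases le_total x (u 0) with h | h
    · have h1 : 0 < u 0 + b := by linarith
      refine ⟨(x + b) / (u 0 + b), div_pos (by linarith) h1, ?_⟩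
      have := hP hl hu (a := 1 - (x + b) / (u 0 + b)) (b := (x + b) / (u 0 + b))
        (sub_nonneg.2 ((div_le_one h1).2 (by linarith)))
        (div_pos (by linarith) h1).le (by ring)
      convert this using 1
      apply ext_E2 <;> simp
      field_simp; ring
    · have h1 : 0 < b - u 0 := by linarith
      refine ⟨(b - x) / (b - u 0), div_pos (by linarith) h1, ?_⟩
      have := hP hr hu (a := 1 - (b - x) / (b - u 0)) (b := (b - x) / (b - u 0))
        (sub_nonneg.2 ((div_le_one h1).2 (by linarith)))
        (div_pos (by linarith) h1).le (by ring)
      convert this using 1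
      apply ext_E2 <;> simp
      field_simp; ring
  have e : (τ / 2 * u 1 - 0) / (τ * u 1 - 0) = 1 / 2 := by
    field_simp; simp
  refine ⟨τ / 2 * u 1, ?_, mem_interior_of_triangle hP hl hr hτ hx ?_ ?_⟩
  · rw [mul_div_cancel_right₀ _ hu1]; linarith
  · rw [e]; norm_num
  · rw [e]; norm_num

lemma IsCentredDoubleArch.chord_mem_interior {P : Set E2} {b : ℝ} (h : IsCentredDoubleArch b P)
    (hP : Convex ℝ P) {x : ℝ} (hx : |x| < b) : !₂[x, 0] ∈ interior P := by
  obtain ⟨u, hu, hub, hu1⟩ := h.exists_above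
  obtain ⟨l, hl, hlb, hl1⟩ := h.exists_below
  obtain ⟨y, hy, hyP⟩ := exists_mem_interior_of_apex hP h.left_mem h.right_mem hu hub hu1.ne' hx
  obtain ⟨z, hz, hzP⟩ := exists_mem_interior_of_apex hP h.left_mem h.right_mem hl hlb hl1.ne hx
  have hy : 0 < y := (div_pos_iff_of_pos_right hu1).1 hy
  have hz : z < 0 := by
    rcases div_pos_iff.1 hz with h | h
    · linarith
    · exact h.1
  have := hP.interior hyP hzP (a := -z / (y - z)) (b := y / (y - z))
    (div_nonneg (by linarith) (by linarith)) (div_nonneg (by linarith) (by linarith))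
    (by rw [← add_div, div_eq_one_iff_eq] <;> linarith)
  convert this using 1
  have : y - z ≠ 0 := by linarith
  apply ext_E2 <;> simp
  · field_simp; ring
  · field_simp; ring

/-- Moving a point of the strip vertically towards the chord brings it into the interior. -/
lemma IsCentredDoubleArch.shrink_mem_interior {P : Set E2} {b : ℝ} (h : IsCentredDoubleArch b P)
    (hP : Convex ℝ P) {p : E2} (hp : p ∈ P) (hpb : |p 0| < b) {τ : ℝ} (h0 : 0 < τ) (h1 : τ < 1) :
    !₂[p 0, τ * p 1] ∈ interior P := by
  by_cases hp1 : p 1 = 0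
  · simpa [hp1] using h.chord_mem_interior hP hpb
  · have e : (τ * p 1 - 0) / (p 1 - 0) = τ := by field_simp; simp
    exact mem_interior_of_triangle hP h.left_mem h.right_mem (by rwa [E2_eta]) hpb
      (by rwa [e]) (by rwa [e])

/-- After a congruence, the chord of a nontrivial double arch is centred on the `x`-axis. -/
lemma IsNontrivialDoubleArch.exists_centred {P : Set E2} (h : IsNontrivialDoubleArch P) :
    ∃ (e : E2 ≃ᵃⁱ[ℝ] E2) (b : ℝ), IsCentredDoubleArch b (e '' P) := by
  obtain ⟨e, a, b, _, _, hab, ⟨W, hW, hWs, rfl⟩, ⟨W', hW', hWs', rfl⟩, he⟩ := h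
  set A := convexHull ℝ ({!₂[a, 0], !₂[b, 0]} ∪ (W : Set E2))
  set A' := convexHull ℝ ({!₂[a, 0], !₂[b, 0]} ∪ (W' : Set E2))
  set m := (a + b) / 2 with hm
  have hAm : ∀ p ∈ {!₂[a, 0], !₂[b, 0]} ∪ (W : Set E2), p ∈ A := fun p hp =>
    subset_convexHull ℝ _ hp
  have hAm' : ∀ p ∈ {!₂[a, 0], !₂[b, 0]} ∪ (W' : Set E2), p ∈ A' := fun p hp =>
    subset_convexHull ℝ _ hp
  have hstrip : ∀ V : Finset E2, (∀ w ∈ V, 0 < w 1 ∧ a < w 0 ∧ w 0 < b) →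
      ∀ p ∈ convexHull ℝ ({!₂[a, 0], !₂[b, 0]} ∪ (V : Set E2)),
        (a < p 0 ∧ p 0 < b) ∨ p = !₂[a, 0] ∨ p = !₂[b, 0] := by
    intro V hV p hp
    have hc : Convex ℝ {p : E2 | (a < p 0 ∧ p 0 < b) ∨ p = !₂[a, 0] ∨ p = !₂[b, 0]} := by
      refine convex_iff_forall_pos.2 fun p hp q hq s t hs ht hst => ?_
      have hge (p : E2) (hp : (a < p 0 ∧ p 0 < b) ∨ p = !₂[a, 0] ∨ p = !₂[b, 0]) :
          a ≤ p 0 ∧ p 0 ≤ b ∧ (p 0 = a → p = !₂[a, 0]) ∧ (p 0 = b → p = !₂[b, 0]) := by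
        rcases hp with h | rfl | rfl
        · exact ⟨h.1.le, h.2.le, fun e => absurd e h.1.ne', fun e => absurd e h.2.ne⟩
        · exact ⟨le_rfl, hab.le, fun _ => rfl, fun e => absurd e hab.ne⟩
        · exact ⟨hab.le, le_rfl, fun e => absurd e hab.ne', fun _ => rfl⟩
      obtain ⟨p1, p2, p3, p4⟩ := hge p hp
      obtain ⟨q1, q2, q3, q4⟩ := hge q hq
      by_cases e1 : p 0 = a ∧ q 0 = a
      · rw [p3 e1.1, q3 e1.2, ← add_smul, hst, one_smul]; exact .inr (.inl rfl)
      by_cases e2 : p 0 = b ∧ q 0 = b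
      · rw [p4 e2.1, q4 e2.2, ← add_smul, hst, one_smul]; exact .inr (.inr rfl)
      refine .inl ⟨?_, ?_⟩
      · change a < s * p 0 + t * q 0
        have hsum : s * a + t * a = a := by rw [← add_mul, hst, one_mul]
        rcases p1.lt_or_eq with h | h
        · linarith [mul_lt_mul_of_pos_left h hs, mul_le_mul_of_nonneg_left q1 ht.le]
        · have : a < q 0 := lt_of_le_of_ne q1 fun h' => e1 ⟨h.symm, h'.symm⟩
          linarith [mul_lt_mul_of_pos_left this ht, mul_le_mul_of_nonneg_left p1 hs.le]
      · change s * p 0 + t * q 0 < b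
        have hsum : s * b + t * b = b := by rw [← add_mul, hst, one_mul]
        rcases p2.lt_or_eq with h | h
        · linarith [mul_lt_mul_of_pos_left h hs, mul_le_mul_of_nonneg_left q2 ht.le]
        · have : q 0 < b := lt_of_le_of_ne q2 fun h' => e2 ⟨h, h'⟩
          linarith [mul_lt_mul_of_pos_left this ht, mul_le_mul_of_nonneg_left p2 hs.le]
    refine convexHull_min ?_ hc hp
    rintro w ((rfl | rfl) | hw)
    · exact .inr (.inl rfl)
    · exact .inr (.inr rfl)
    · exact .inl (hV w hw).2
  let T : E2 ≃ᵃⁱ[ℝ] E2 := AffineIsometryEquiv.constVAdd ℝ E2 !₂[-m, 0]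
  have hT (p : E2) : T p = !₂[p 0 - m, p 1] := by
    change !₂[-m, 0] + p = _
    apply ext_E2 <;> simp
    ring
  have himg : (e.trans T) '' P = T '' (A ∪ flip '' A') := by
    rw [← he, image_image]; rfl
  refine ⟨e.trans T, (b - a) / 2, by linarith, ?_, ?_, ?_, ?_, ?_⟩ <;> rw [himg]
  · refine ⟨!₂[a, 0], .inl (hAm _ (by simp)), ?_⟩
    rw [hT]; apply ext_E2 <;> simp [hm]; ring
  · refine ⟨!₂[b, 0], .inl (hAm _ (by simp)), ?_⟩
    rw [hT]; apply ext_E2 <;> simp [hm]; ring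
  · obtain ⟨w, hw⟩ := hW
    obtain ⟨h1, h2, h3⟩ := hWs w hw
    refine ⟨_, ⟨w, .inl (hAm _ (by simp [hw])), hT w⟩, ?_, by simpa⟩
    simp only [hm, abs_lt]
    constructor <;> simp <;> linarith
  · obtain ⟨w, hw⟩ := hW'
    obtain ⟨h1, h2, h3⟩ := hWs' w hw
    refine ⟨_, ⟨flip w, .inr ⟨w, hAm' _ (by simp [hw]), rfl⟩, hT _⟩, ?_, by simpa [flip]⟩
    simp only [hm, abs_lt, flip]
    constructor <;> simp <;> linarith
  · rintro _ ⟨p, hp, rfl⟩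
    have hp' : (a < p 0 ∧ p 0 < b) ∨ p = !₂[a, 0] ∨ p = !₂[b, 0] := by
      rcases hp with hp | ⟨p, hp, rfl⟩
      · exact hstrip W hWs p hp
      · rcases hstrip W' hWs' p hp with h | rfl | rfl
        · exact .inl h
        · exact .inr (.inl (by apply ext_E2 <;> simp [flip]))
        · exact .inr (.inr (by apply ext_E2 <;> simp [flip]))
    rw [hT]
    rcases hp' with h | rfl | rfl
    · left
      simp only [hm, abs_lt]
      constructor <;> simp <;> linarith
    · right; left
      apply ext_E2 <;> simp [hm]; ring
    · right; right
      apply ext_E2 <;> simp [hm]; ring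

/-! ### Small rotations -/

/-- The rotation by `θ` about the `x`-axis. -/
def rotX (θ : ℝ) : SO3 :=
  ⟨!![1, 0, 0; 0, Real.cos θ, -Real.sin θ; 0, Real.sin θ, Real.cos θ], mem_SO3_of_columns _
    (by
      have := Real.sin_sq_add_cos_sq θ
      ext i j
      fin_cases i <;> fin_cases j <;> simp [Matrix.mul_apply, Fin.sum_univ_three] <;> linarith)
    (by
      rw [Matrix.det_fin_three]
      simp
      linarith [Real.sin_sq_add_cos_sq θ])⟩

/-- The rotation by `ψ` about the `y`-axis. -/
def rotY (ψ : ℝ) : SO3 :=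
  ⟨!![Real.cos ψ, 0, Real.sin ψ; 0, 1, 0; -Real.sin ψ, 0, Real.cos ψ], mem_SO3_of_columns _
    (by
      have := Real.sin_sq_add_cos_sq ψ
      ext i j
      fin_cases i <;> fin_cases j <;> simp [Matrix.mul_apply, Fin.sum_univ_three] <;> linarith)
    (by
      rw [Matrix.det_fin_three]
      simp
      linarith [Real.sin_sq_add_cos_sq ψ])⟩

/-- The rotation by `ω` about the `z`-axis. -/
def rotZ (ω : ℝ) : SO3 :=
  ⟨!![Real.cos ω, -Real.sin ω, 0; Real.sin ω, Real.cos ω, 0; 0, 0, 1], mem_SO3_of_columns _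
    (by
      have := Real.sin_sq_add_cos_sq ω
      ext i j
      fin_cases i <;> fin_cases j <;> simp [Matrix.mul_apply, Fin.sum_univ_three] <;> linarith)
    (by
      rw [Matrix.det_fin_three]
      simp
      linarith [Real.sin_sq_add_cos_sq ω])⟩

lemma proj_rotX (θ : ℝ) (x : E3) :
    proj (rotate (rotX θ) x) = !₂[x 0, Real.cos θ * x 1 - Real.sin θ * x 2] := by
  apply ext_E2 <;> simp [rotate_apply, rotX]
  ring

lemma proj_rotY (ψ : ℝ) (x : E3) :
    proj (rotate (rotY ψ) x) = !₂[Real.cos ψ * x 0 + Real.sin ψ * x 2, x 1] := by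
  apply ext_E2 <;> simp [rotate_apply, rotY]

/-- The rotation of the plane by the angle `ω`. -/
def spin (ω : ℝ) : E2 ≃ₗᵢ[ℝ] E2 where
  toFun p := !₂[Real.cos ω * p 0 - Real.sin ω * p 1, Real.sin ω * p 0 + Real.cos ω * p 1]
  map_add' p q := by apply ext_E2 <;> simp <;> ring
  map_smul' a p := by apply ext_E2 <;> simp <;> ring
  invFun p := !₂[Real.cos ω * p 0 + Real.sin ω * p 1, -Real.sin ω * p 0 + Real.cos ω * p 1]
  left_inv p := by
    have := Real.sin_sq_add_cos_sq ω
    apply ext_E2 <;> simp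
    · linear_combination (p 0) * this
    · linear_combination (p 1) * this
  right_inv p := by
    have := Real.sin_sq_add_cos_sq ω
    apply ext_E2 <;> simp
    · linear_combination (p 0) * this
    · linear_combination (p 1) * this
  norm_map' p := by
    rw [norm_eq_sqrt_real_inner, norm_eq_sqrt_real_inner (x := p), inner_E2, inner_E2]
    congr 1
    simp
    linear_combination (p 0 ^ 2 + p 1 ^ 2) * Real.sin_sq_add_cos_sq ω

lemma spin_apply (ω : ℝ) (p : E2) :
    spin ω p = !₂[Real.cos ω * p 0 - Real.sin ω * p 1, Real.sin ω * p 0 + Real.cos ω * p 1] := rfl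

lemma spin_symm_apply (ω : ℝ) (p : E2) : (spin ω).symm p =
    !₂[Real.cos ω * p 0 + Real.sin ω * p 1, -Real.sin ω * p 0 + Real.cos ω * p 1] := rfl

lemma proj_rotZ (ω : ℝ) (x : E3) : proj (rotate (rotZ ω) x) = spin ω (proj x) := by
  rw [spin_apply]
  apply ext_E2 <;> simp [rotate_apply, rotZ]
  ring

/-- The trace in the hypothesis is that of a product of rotations by `ψ` and `θ` about two
orthogonal axes. The order of the quantifiers lets `ψ` be chosen small in terms of `θ`. -/
lemma eventually_rotationSize_lt {f : ℝ → ℝ → SO3}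
    (hf : ∀ ψ θ, Matrix.trace (f ψ θ : Matrix (Fin 3) (Fin 3) ℝ)
      = Real.cos ψ + Real.cos θ + Real.cos ψ * Real.cos θ) {ε : ℝ} (hε : 0 < ε) :
    ∀ᶠ θ in 𝓝[>] (0 : ℝ), ∀ᶠ ψ in 𝓝[>] (0 : ℝ), rotationSize (f ψ θ) < ε := by
  have hc : Continuous fun p : ℝ × ℝ => rotationSize (f p.2 p.1) := by
    simp only [rotationSize, hf]
    exact Real.continuous_arccos.comp (by fun_prop)
  have h0 : rotationSize (f 0 0) = 0 := by
    rw [rotationSize, hf]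
    norm_num
  have h1 : ∀ᶠ p : ℝ × ℝ in 𝓝 (0, 0), rotationSize (f p.2 p.1) < ε :=
    hc.continuousAt.eventually (gt_mem_nhds (by simpa [h0] using hε))
  rw [nhds_prod_eq] at h1
  exact (h1.curry.filter_mono nhdsWithin_le_nhds).mono
    fun θ h => h.filter_mono nhdsWithin_le_nhds

lemma trace_rotY_mul_rotX (ψ θ : ℝ) :
    Matrix.trace ((rotY ψ * rotX θ : SO3) : Matrix (Fin 3) (Fin 3) ℝ)
      = Real.cos ψ + Real.cos θ + Real.cos ψ * Real.cos θ := by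
  rw [Matrix.trace_fin_three]
  simp [rotX, rotY]

lemma trace_rotZ_mul_rotX (ω θ : ℝ) :
    Matrix.trace ((rotZ ω * rotX θ : SO3) : Matrix (Fin 3) (Fin 3) ℝ)
      = Real.cos ω + Real.cos θ + Real.cos ω * Real.cos θ := by
  rw [Matrix.trace_fin_three]
  simp [rotX, rotZ]
  ring

lemma eventually_sin_cos : ∀ᶠ θ in 𝓝[>] (0 : ℝ),
    0 < Real.sin θ ∧ 0 < Real.cos θ ∧ Real.cos θ < 1 := by
  filter_upwards [Ioo_mem_nhdsGT (show (0 : ℝ) < Real.pi / 2 by positivity)] with θ hθ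
  have hs : 0 < Real.sin θ := Real.sin_pos_of_pos_of_lt_pi hθ.1 (by linarith [hθ.2, Real.pi_pos])
  have hc : 0 < Real.cos θ := Real.cos_pos_of_mem_Ioo ⟨by linarith [hθ.1, Real.pi_pos], hθ.2⟩
  exact ⟨hs, hc, by nlinarith [Real.sin_sq_add_cos_sq θ]⟩

/-! ### Rupert rotations from a flat double arch -/

/-- A rotation about the chord moves every vertex except the two endpoints of the chord over the
interior of `P`; a much smaller rotation about the perpendicular axis in the section plane then
shortens the chord. -/
theorem IsCentredDoubleArch.orientedLocallyRupert {P : Set E2} {b : ℝ}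
    (h : IsCentredDoubleArch b P) (hP : Convex ℝ P) {V : Finset E3}
    (hV : ∀ v ∈ V, proj v ∈ P ∧ (proj v ∈ interior P ∨ v 2 = 0))
    (hPQ : P ⊆ proj '' convexHull ℝ (V : Set E3)) :
    OrientedLocallyRupert (convexHull ℝ (V : Set E3)) := by
  intro ε hε
  have hb := h.pos
  have hend (x : E3) (s : ℝ) (hs : |s| = b) (hx : x = !₂[s, 0, 0]) :
      ∀ θ, ∀ᶠ ψ in 𝓝[>] (0 : ℝ), proj (rotate (rotY ψ * rotX θ) x) ∈ interior P := by
    intro θ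
    filter_upwards [eventually_sin_cos] with ψ hψ
    have : proj (rotate (rotY ψ * rotX θ) x) = !₂[Real.cos ψ * s, 0] := by
      rw [rotate_mul, proj_rotY, hx]
      apply ext_E2 <;> simp [rotate_apply, rotX]
    rw [this]
    apply h.chord_mem_interior hP
    rw [abs_mul, hs, abs_of_pos hψ.2.1]
    nlinarith
  have key : ∀ v ∈ V, ∀ᶠ θ in 𝓝[>] (0 : ℝ), ∀ᶠ ψ in 𝓝[>] (0 : ℝ),
      proj (rotate (rotY ψ * rotX θ) v) ∈ interior P := by
    intro v hv
    have hopen (θ : ℝ) (hθ : proj (rotate (rotX θ) v) ∈ interior P) :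
        ∀ᶠ ψ in 𝓝[>] (0 : ℝ), proj (rotate (rotY ψ * rotX θ) v) ∈ interior P := by
      simp only [rotate_mul, proj_rotY]
      have hc : Continuous fun ψ : ℝ => (!₂[Real.cos ψ * rotate (rotX θ) v 0
          + Real.sin ψ * rotate (rotX θ) v 2, rotate (rotX θ) v 1] : E2) := by fun_prop
      refine (hc.continuousAt.eventually (isOpen_interior.eventually_mem ?_)).filter_mono
        nhdsWithin_le_nhds
      convert hθ using 1
      apply ext_E2 <;> simp
    obtain ⟨hvP, hi | h0⟩ := hV v hv
    · have hc : Continuous fun θ : ℝ =>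
          (!₂[v 0, Real.cos θ * v 1 - Real.sin θ * v 2] : E2) := by fun_prop
      have : ∀ᶠ θ in 𝓝[>] (0 : ℝ), proj (rotate (rotX θ) v) ∈ interior P := by
        simp only [proj_rotX]
        refine (hc.continuousAt.eventually (isOpen_interior.eventually_mem ?_)).filter_mono
          nhdsWithin_le_nhds
        convert hi using 1
        apply ext_E2 <;> simp
      exact this.mono hopen
    · rcases h.strip _ hvP with hs | hs | hs
      · filter_upwards [eventually_sin_cos] with θ hθ
        apply hopen
        rw [proj_rotX, h0]
        simpa using h.shrink_mem_interior hP hvP hs hθ.2.1 hθ.2.2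
      · refine Eventually.of_forall (hend v (-b) (by simp [hb.le]) ?_)
        rw [eq_embed_proj h0, hs]
        rfl
      · refine Eventually.of_forall (hend v b (by simp [hb.le]) ?_)
        rw [eq_embed_proj h0, hs]
        rfl
  obtain ⟨θ, hθ1, hθ2⟩ := ((eventually_rotationSize_lt trace_rotY_mul_rotX hε).and
    ((Finset.eventually_all V).2 key)).exists
  obtain ⟨ψ, hψ1, hψ2⟩ := (hθ1.and ((Finset.eventually_all V).2 hθ2)).exists
  refine ⟨rotY ψ * rotX θ, hψ1, ?_⟩
  refine Subset.trans ?_ (interior_mono hPQ)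
  have hconv : Convex ℝ ((projₗ ∘ₗ rotateₗ (rotY ψ * rotX θ)) ⁻¹' interior P) :=
    hP.interior.linear_preimage _
  rintro _ ⟨_, ⟨x, hx, rfl⟩, rfl⟩
  exact convexHull_min (s := (V : Set E3)) (fun v hv => hψ2 v hv) hconv hx

/-! ### Reverse Rupert rotations from a prism over a double arch -/

lemma mem_interior_of_rectangle {K : Set E2} (hK : Convex ℝ K) {b η x y : ℝ}
    (h : ∀ s t : ℝ, |s| ≤ b → |t| ≤ η → !₂[s, t] ∈ K) (hx : |x| < b) (hy : |y| < η) :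
    (!₂[x, y] : E2) ∈ interior K := by
  have hη : 0 < η := (abs_nonneg y).trans_lt hy
  have hb : 0 < b := (abs_nonneg x).trans_lt hx
  obtain ⟨h1, h2⟩ := abs_lt.1 hy
  refine mem_interior_of_triangle hK (c := -η) (y' := η)
    (h _ _ (by simp [abs_of_pos hb]) (by simp [abs_of_pos hη]))
    (h _ _ (by simp [abs_of_pos hb]) (by simp [abs_of_pos hη]))
    (h _ _ hx.le (by simp [abs_of_pos hη])) hx ?_ ?_
  · exact div_pos (by linarith) (by linarith)
  · rw [div_lt_one] <;> linarith

/-- A rotation about the chord turns the vertical edges of a prism over the endpoints into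
segments transversal to the chord, so that its projection contains all of `P` but the endpoints
in its interior. The two transversal segments span a strip whose width is the length of the
chord; turning the strip slightly in the plane makes it meet the `x`-axis in a longer chord. -/
theorem IsCentredDoubleArch.orientedLocallyReverseRupert {F : Set E2} {b δ : ℝ} {D : Set E3}
    (h : IsCentredDoubleArch b (convexHull ℝ F)) (hF : F.Finite) (hD : Convex ℝ D) (hδ : 0 < δ)
    (hprism : ∀ y : E3, |y 2| ≤ δ → proj y ∈ convexHull ℝ F → y ∈ D)
    (hproj : ∀ y ∈ D, proj y ∈ convexHull ℝ F) : OrientedLocallyReverseRupert D := by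
  intro ε hε
  have hb := h.pos
  set P := convexHull ℝ F with hPdef
  have hPc : Convex ℝ P := convex_convexHull ℝ F
  set K : ℝ → Set E2 := fun θ => proj '' (rotate (rotX θ) '' D) with hKdef
  have hKc (θ : ℝ) : Convex ℝ (K θ) := by
    have := hD.linear_image (projₗ ∘ₗ rotateₗ (rotX θ))
    simp only [hKdef, image_image]
    exact this
  have hmem (θ : ℝ) {p : E2} (hp : p ∈ P) {z : ℝ} (hz : |z| ≤ δ) :
      !₂[p 0, Real.cos θ * p 1 - Real.sin θ * z] ∈ K θ := by
    refine ⟨_, ⟨!₂[p 0, p 1, z], hprism _ (by simpa using hz) ?_, rfl⟩, ?_⟩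
    · convert hp using 1; exact ext_E2 rfl rfl
    · rw [proj_rotX]; rfl
  have hchord (s : ℝ) (hs : |s| ≤ b) : !₂[s, 0] ∈ P := by
    obtain ⟨h1, h2⟩ := abs_le.1 hs
    have := hPc h.left_mem h.right_mem (a := (b - s) / (2 * b)) (b := (b + s) / (2 * b))
      (div_nonneg (by linarith) (by linarith)) (div_nonneg (by linarith) (by linarith))
      (by field_simp; ring)
    convert this using 1
    apply ext_E2 <;> simp
    field_simp; ring
  have hrect (θ : ℝ) (hθ : 0 < Real.sin θ) (s t : ℝ) (hs : |s| ≤ b)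
      (ht : |t| ≤ δ * Real.sin θ) : !₂[s, t] ∈ K θ := by
    have := hmem θ (hchord s hs) (z := -t / Real.sin θ) (by
      rw [abs_div, abs_neg, abs_of_pos hθ, div_le_iff₀ hθ]; exact ht)
    convert this using 1
    apply ext_E2 <;> simp
    field_simp
  have key : ∀ p ∈ hF.toFinset, ∀ᶠ θ in 𝓝[>] (0 : ℝ), ∀ᶠ ω in 𝓝[>] (0 : ℝ),
      (spin ω).symm p ∈ interior (K θ) := by
    intro p hpF
    have hp : p ∈ P := subset_convexHull ℝ F (hF.mem_toFinset.1 hpF)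
    have hlim : ∀ᶠ θ in 𝓝[>] (0 : ℝ), |p 1| * Real.sin θ < δ := by
      have hc : Continuous fun θ : ℝ => |p 1| * Real.sin θ := by fun_prop
      exact (hc.continuousAt.eventually (gt_mem_nhds (by simpa using hδ))).filter_mono
        nhdsWithin_le_nhds
    filter_upwards [eventually_sin_cos, hlim] with θ ⟨hs, hc0, hc1⟩ hpδ
    set η := δ * Real.sin θ with hη
    have hη0 : 0 < η := mul_pos hδ hs
    -- tilting a face of the prism raises `p` by more than the shrinking of its ordinate costs
    have hgain : |p 1| * (1 - Real.cos θ) < η := by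
      have h1 : 1 - Real.cos θ ≤ Real.sin θ * Real.sin θ := by
        nlinarith [Real.sin_sq_add_cos_sq θ]
      calc |p 1| * (1 - Real.cos θ) ≤ |p 1| * (Real.sin θ * Real.sin θ) := by gcongr
        _ = |p 1| * Real.sin θ * Real.sin θ := by ring
        _ < η := by rw [hη]; gcongr
    rcases h.strip p hp with hpb | hpe
    · have hpK : p ∈ interior (K θ) := by
        rw [← E2_eta p]
        rcases le_total 0 (p 1) with hp1 | hp1
        · rw [abs_of_nonneg hp1] at hgain
          refine mem_interior_of_triangle (hKc θ) (c := -η) (y' := Real.cos θ * p 1 + η)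
            (hrect θ hs _ _ (by simp [abs_of_pos hb]) (by rw [← hη]; simp [abs_of_pos hη0]))
            (hrect θ hs _ _ (by simp [abs_of_pos hb]) (by rw [← hη]; simp [abs_of_pos hη0]))
            ?_ hpb ?_ ?_
          · have := hmem θ hp (z := -δ) (by simp [abs_of_pos hδ])
            rwa [show Real.cos θ * p 1 - Real.sin θ * -δ = Real.cos θ * p 1 + η by
              rw [hη]; ring] at this
          · exact div_pos (by linarith) (by nlinarith)
          · rw [div_lt_one] <;> nlinarith
        · rw [abs_of_nonpos hp1] at hgain
          refine mem_interior_of_triangle (hKc θ) (c := η) (y' := Real.cos θ * p 1 - η)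
            (hrect θ hs _ _ (by simp [abs_of_pos hb]) (by rw [← hη]; simp [abs_of_pos hη0]))
            (hrect θ hs _ _ (by simp [abs_of_pos hb]) (by rw [← hη]; simp [abs_of_pos hη0]))
            ?_ hpb ?_ ?_
          · have := hmem θ hp (z := δ) (by simp [abs_of_pos hδ])
            rwa [show Real.cos θ * p 1 - Real.sin θ * δ = Real.cos θ * p 1 - η by
              rw [hη]; ring] at this
          · exact div_pos_of_neg_of_neg (by linarith) (by nlinarith)
          · rw [div_lt_one_of_neg] <;> nlinarith
      simp only [spin_symm_apply]
      have hcont : Continuous fun ω : ℝ => (!₂[Real.cos ω * p 0 + Real.sin ω * p 1,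
          -Real.sin ω * p 0 + Real.cos ω * p 1] : E2) := by fun_prop
      refine (hcont.continuousAt.eventually (isOpen_interior.eventually_mem ?_)).filter_mono
        nhdsWithin_le_nhds
      convert hpK using 1
      apply ext_E2 <;> simp
    -- an endpoint only reaches the boundary of `K θ`, at the middle of a side of the rectangle;
    -- the turn by `ω` moves it into the open rectangle
    · obtain ⟨hp0, hp1⟩ : |p 0| = b ∧ p 1 = 0 := by
        rcases hpe with rfl | rfl <;> simp [hb.le]
      have hlim' : ∀ᶠ ω in 𝓝[>] (0 : ℝ), |-Real.sin ω * p 0| < η := by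
        have hc : Continuous fun ω : ℝ => |-Real.sin ω * p 0| := by fun_prop
        exact (hc.continuousAt.eventually (gt_mem_nhds (by simpa using hη0))).filter_mono
          nhdsWithin_le_nhds
      filter_upwards [eventually_sin_cos, hlim'] with ω ⟨_, hω0, hω1⟩ hω
      rw [spin_symm_apply, hp1, mul_zero, mul_zero, add_zero, add_zero]
      refine mem_interior_of_rectangle (hKc θ) (hrect θ hs) ?_ hω
      rw [abs_mul, hp0, abs_of_pos hω0]
      nlinarith
  obtain ⟨θ, hθ1, hθ2⟩ := ((eventually_rotationSize_lt trace_rotZ_mul_rotX hε).and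
    ((Finset.eventually_all _).2 key)).exists
  obtain ⟨ω, hω1, hω2⟩ := (hθ1.and ((Finset.eventually_all _).2 hθ2)).exists
  refine ⟨rotZ ω * rotX θ, hω1, ?_⟩
  have himg : proj '' (rotate (rotZ ω * rotX θ) '' D) = spin ω '' K θ := by
    simp only [hKdef, image_image, rotate_mul, proj_rotZ]
  have hconv : Convex ℝ ((spin ω).symm.toLinearEquiv.toLinearMap ⁻¹' interior (K θ)) :=
    (hKc θ).interior.linear_preimage _
  have hPK : P ⊆ (spin ω).symm.toLinearEquiv.toLinearMap ⁻¹' interior (K θ) :=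
    convexHull_min (fun p hp => hω2 p (hF.mem_toFinset.2 hp)) hconv
  rw [IsReverseRupertRotation, himg]
  have hint : spin ω '' interior (K θ) = interior (spin ω '' K θ) :=
    (spin ω).toHomeomorph.image_interior _
  rw [← hint]
  rintro _ ⟨y, hy, rfl⟩
  exact ⟨_, hPK (hproj y hy), (spin ω).apply_symm_apply _⟩

/-! ### Reciprocals of regular polygons -/

/-- The unit vector of the plane in the direction `α`. -/
def dir (α : ℝ) : E2 := !₂[Real.cos α, Real.sin α]

@[simp] lemma dir_zero (α : ℝ) : dir α 0 = Real.cos α := rfl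
@[simp] lemma dir_one (α : ℝ) : dir α 1 = Real.sin α := rfl

lemma inner_dir (α β : ℝ) : inner ℝ (dir α) (dir β) = Real.cos (α - β) := by
  rw [inner_E2, Real.cos_sub]; rfl

lemma exists_eq_smul_dir (q : E2) : ∃ ρ α : ℝ, 0 ≤ ρ ∧ q = ρ • dir α := by
  refine ⟨‖(⟨q 0, q 1⟩ : ℂ)‖, Complex.arg ⟨q 0, q 1⟩, norm_nonneg _, ?_⟩
  apply ext_E2
  · simp
  · simp

/-- The vertices of the regular `n`-gon with centre `o`, circumradius `s` and phase `φ`. -/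
def vertices (n : ℕ) (o : E2) (s φ : ℝ) : Set E2 :=
  range fun k : Fin n => o + s • dir (φ + 2 * Real.pi * (k : ℕ) / n)

lemma mem_vertices {n : ℕ} (hn : 0 < n) (o : E2) (s φ : ℝ) (j : ℤ) :
    o + s • dir (φ + 2 * Real.pi * j / n) ∈ vertices n o s φ := by
  have hn' : (n : ℤ) ≠ 0 := by exact_mod_cast hn.ne'
  obtain ⟨k, hk⟩ := Int.eq_ofNat_of_zero_le (Int.emod_nonneg j hn')
  have hkn : k < n := by
    have := Int.emod_lt_of_pos j (show (0 : ℤ) < n by exact_mod_cast hn)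
    omega
  refine ⟨⟨k, hkn⟩, ?_⟩
  have hj : (j : ℝ) = k + n * (j / n : ℤ) := by
    have := Int.emod_add_mul_ediv j n
    rw [hk] at this
    exact_mod_cast this.symm
  have hnr : (n : ℝ) ≠ 0 := by exact_mod_cast hn.ne'
  have e : φ + 2 * Real.pi * j / n = φ + 2 * Real.pi * k / n + (j / n : ℤ) * (2 * Real.pi) := by
    rw [hj]; field_simp; ring
  have : dir (φ + 2 * Real.pi * j / n) = dir (φ + 2 * Real.pi * k / n) := by
    rw [e]
    apply ext_E2 <;> simp only [dir_zero, dir_one, Real.cos_add_int_mul_two_pi,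
      Real.sin_add_int_mul_two_pi]
  rw [this]

lemma abs_sub_round_mul_le {d : ℝ} (hd : 0 < d) (x : ℝ) : |x - round (x / d) * d| ≤ d / 2 := by
  have h := abs_sub_round (x / d)
  have e : x - round (x / d) * d = (x / d - round (x / d)) * d := by field_simp
  rw [e, abs_mul, abs_of_pos hd]
  nlinarith

lemma cos_pi_div_pos {n : ℕ} (hn : 3 ≤ n) : 0 < Real.cos (Real.pi / n) := by
  have hnr : (3 : ℝ) ≤ n := by exact_mod_cast hn
  have h1 : Real.pi / n < Real.pi / 2 :=
    div_lt_div_of_pos_left Real.pi_pos (by norm_num) (by linarith)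
  have h2 : 0 < Real.pi / n := div_pos Real.pi_pos (by linarith)
  exact Real.cos_pos_of_mem_Ioo ⟨by linarith, h1⟩

/-- Among the odd multiples of `π / n`, the angle `π / n` itself has the largest cosine. -/
lemma cos_odd_mul_le {n : ℕ} (hn : 0 < n) {m : ℤ} (hm : Odd m) :
    Real.cos (m * (Real.pi / n)) ≤ Real.cos (Real.pi / n) := by
  have hnr : (0 : ℝ) < n := by exact_mod_cast hn
  set q := round ((m : ℝ) / (2 * n)) with hq
  have h1 := abs_sub_round_mul_le (show (0 : ℝ) < 2 * n by positivity) m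
  rw [← hq] at h1
  obtain ⟨a, ha⟩ := hm
  have h2 : (1 : ℝ) ≤ |(m : ℝ) - q * (2 * n)| := by
    have : (1 : ℤ) ≤ |m - q * (2 * n)| := by
      apply Int.one_le_abs
      rw [ha]
      intro h
      have : 2 * (q * n - a) = 1 := by linarith
      omega
    exact_mod_cast this
  have e : (m : ℝ) * (Real.pi / n)
      = ((m : ℝ) - q * (2 * n)) * (Real.pi / n) + q * (2 * Real.pi) := by
    field_simp; ring
  have hpn : 0 < Real.pi / n := div_pos Real.pi_pos hnr
  rw [e, Real.cos_add_int_mul_two_pi, ← Real.cos_abs, abs_mul, abs_of_pos hpn]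
  refine Real.cos_le_cos_of_nonneg_of_le_pi hpn.le ?_ (by nlinarith)
  calc |(m : ℝ) - q * (2 * n)| * (Real.pi / n) ≤ n * (Real.pi / n) := by
        gcongr; linarith
    _ = Real.pi := by field_simp

/-- The ray from the centre in the direction `α` meets an edge of the regular polygon at the
distance `κ`, and a point of the polar on this ray is at most that far out. -/
lemma exists_edge_point {n : ℕ} (hn : 3 ≤ n) (o : E2) {s r : ℝ} (hs : 0 < s) (hr : 0 < r)
    (φ α : ℝ) : ∃ κ : ℝ, 0 < κ ∧
      o + κ • dir α ∈
        convexHull ℝ (vertices n o (r ^ 2 / (s * Real.cos (Real.pi / n))) (φ + Real.pi / n)) ∧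
      ∀ ρ, o + ρ • dir α ∈ polar o r (convexHull ℝ (vertices n o s φ)) → ρ ≤ κ := by
  have hn0 : 0 < n := by omega
  have hnr : (3 : ℝ) ≤ n := by exact_mod_cast hn
  set γ := Real.pi / n with hγ
  have hγ0 : 0 < γ := div_pos Real.pi_pos (by linarith)
  have hγ1 : γ < Real.pi / 2 := by
    rw [hγ]; exact div_lt_div_of_pos_left Real.pi_pos (by norm_num) (by linarith)
  set j := round ((α - φ) / (2 * γ)) with hj
  have hβ := abs_sub_round_mul_le (show (0 : ℝ) < 2 * γ by positivity) (α - φ)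
  rw [← hj] at hβ
  -- `μ` is the direction of the vertex of the original polygon nearest to the ray
  set β := α - φ - j * (2 * γ) with hβdef
  obtain ⟨hβ0, hβ1⟩ := abs_le.1 hβ
  set μ := φ + j * (2 * γ) with hμ
  have hα : α = μ + β := by rw [hβdef, hμ]; ring
  have hcβ : 0 < Real.cos β := Real.cos_pos_of_mem_Ioo ⟨by linarith, by linarith⟩
  have hcγ : 0 < Real.cos γ := Real.cos_pos_of_mem_Ioo ⟨by linarith, by linarith⟩
  have hsγ : 0 < Real.sin γ := Real.sin_pos_of_pos_of_lt_pi hγ0 (by linarith)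
  set s' := r ^ 2 / (s * Real.cos γ) with hs'
  have hs'0 : 0 < s' := by positivity
  refine ⟨s' * Real.cos γ / Real.cos β, by positivity, ?_, fun ρ hρ => ?_⟩
  · have hw1 : o + s' • dir (μ + γ) ∈ vertices n o s' (φ + γ) := by
      convert mem_vertices hn0 o s' (φ + γ) j using 4
      rw [hμ, hγ]; ring
    have hw2 : o + s' • dir (μ - γ) ∈ vertices n o s' (φ + γ) := by
      convert mem_vertices hn0 o s' (φ + γ) (j - 1) using 4
      rw [hμ, hγ]; push_cast; ring
    -- the weights of the two ends of the edge are `(1 ± T) / 2`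
    set T := Real.sin β * Real.cos γ / (Real.sin γ * Real.cos β) with hT
    have hp : 0 < Real.sin γ * Real.cos β := by positivity
    have h1 : T ≤ 1 := by
      rw [hT, div_le_one hp]
      have := Real.sin_nonneg_of_nonneg_of_le_pi (x := γ - β) (by linarith) (by linarith)
      rw [Real.sin_sub] at this
      linarith
    have h2 : -1 ≤ T := by
      rw [hT, le_div_iff₀ hp]
      have := Real.sin_nonneg_of_nonneg_of_le_pi (x := γ + β) (by linarith) (by linarith)
      rw [Real.sin_add] at this
      linarith
    have := convex_convexHull ℝ (vertices n o s' (φ + γ)) (subset_convexHull ℝ _ hw1)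
      (subset_convexHull ℝ _ hw2) (a := (1 + T) / 2) (b := (1 - T) / 2)
      (by linarith) (by linarith) (by ring)
    convert this using 1
    have hTm : T * Real.sin γ * Real.cos β = Real.sin β * Real.cos γ := by
      rw [hT]; field_simp
    rw [hα]
    apply ext_E2 <;>
      simp only [PiLp.add_apply, PiLp.smul_apply, smul_eq_mul, dir_zero, dir_one, Real.cos_add,
        Real.cos_sub, Real.sin_add, Real.sin_sub] <;> rw [div_mul_eq_mul_div, ← sub_eq_zero] <;>
      field_simp
    · linear_combination (2 * s' * Real.sin μ) * hTm
    · linear_combination (-2 * s' * Real.cos μ) * hTm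
  · rw [polar_convexHull] at hρ
    have := hρ _ (mem_vertices hn0 o s φ j)
    rw [add_sub_cancel_left, add_sub_cancel_left, real_inner_smul_left, real_inner_smul_right,
      inner_dir, show φ + 2 * Real.pi * j / n - α = -β by rw [hβdef, hγ]; ring,
      Real.cos_neg] at this
    rw [le_div_iff₀ hcβ, hs']
    have e : r ^ 2 / (s * Real.cos γ) * Real.cos γ = r ^ 2 / s := by field_simp
    rw [e, le_div_iff₀ hs]
    linarith

/-- The reciprocal of a regular polygon in a concentric circle is the regular polygon whose
vertices point to the midpoints of the edges. -/
theorem polar_vertices {n : ℕ} (hn : 3 ≤ n) (o : E2) {s r : ℝ} (hs : 0 < s) (hr : 0 < r)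
    (φ : ℝ) : polar o r (convexHull ℝ (vertices n o s φ)) =
      convexHull ℝ (vertices n o (r ^ 2 / (s * Real.cos (Real.pi / n))) (φ + Real.pi / n)) := by
  have hn0 : 0 < n := by omega
  apply Subset.antisymm
  · intro y hy
    obtain ⟨ρ, α, hρ, hy'⟩ := exists_eq_smul_dir (y - o)
    obtain rfl : y = o + ρ • dir α := by rw [← hy']; abel
    obtain ⟨κ, hκ, hκm, hκle⟩ := exists_edge_point hn o hs hr φ α
    obtain ⟨κ', hκ', hκm', -⟩ := exists_edge_point hn o hs hr φ (α + Real.pi)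
    have hle := hκle ρ hy
    -- the point lies between the edge points in its own and in the opposite direction
    have := convex_convexHull ℝ _ hκm hκm' (a := (ρ + κ') / (κ + κ')) (b := (κ - ρ) / (κ + κ'))
      (by positivity) (div_nonneg (by linarith) (by linarith)) (by field_simp; ring)
    convert this using 1
    apply ext_E2 <;> simp <;> field_simp <;> ring
  · have hc := cos_pi_div_pos hn
    refine convexHull_min ?_ (convex_polar _ _ _)
    rintro _ ⟨k, rfl⟩
    rw [polar_convexHull]
    rintro _ ⟨l, rfl⟩
    rw [add_sub_cancel_left, add_sub_cancel_left, real_inner_smul_left, real_inner_smul_right,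
      inner_dir]
    have e : φ + 2 * Real.pi * (l : ℕ) / n - (φ + Real.pi / n + 2 * Real.pi * (k : ℕ) / n)
        = ((2 * ((l : ℕ) - (k : ℕ) - 1) + 1 : ℤ) : ℝ) * (Real.pi / n) := by
      push_cast; ring
    rw [e]
    calc s * (r ^ 2 / (s * Real.cos (Real.pi / n)) * Real.cos _)
        ≤ s * (r ^ 2 / (s * Real.cos (Real.pi / n)) * Real.cos (Real.pi / n)) := by
          gcongr
          exact cos_odd_mul_le hn0 ⟨_, rfl⟩
      _ = r ^ 2 := by field_simp

lemma IsNontrivialArch.smul {a b l : ℝ} {A : Set E2} (hl : 0 < l) (h : IsNontrivialArch a b A) :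
    IsNontrivialArch (l * a) (l * b) ((fun p => l • p) '' A) := by
  classical
  obtain ⟨W, hW, hWs, rfl⟩ := h
  refine ⟨W.image fun p => l • p, hW.image _, ?_, ?_⟩
  · intro w hw
    obtain ⟨v, hv, rfl⟩ := Finset.mem_image.1 hw
    obtain ⟨h1, h2, h3⟩ := hWs v hv
    simp only [PiLp.smul_apply, smul_eq_mul]
    exact ⟨by positivity, by gcongr, by gcongr⟩
  · have := (LinearMap.lsmul ℝ E2 l).image_convexHull ({!₂[a, 0], !₂[b, 0]} ∪ (W : Set E2))
    have e (x : ℝ) : l • (!₂[x, 0] : E2) = !₂[l * x, 0] := by apply ext_E2 <;> simp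
    simp only [LinearMap.lsmul_apply, image_union, image_pair, e] at this
    rw [Finset.coe_image]
    exact this

/-- Nontrivial double arches are preserved by similarities of the plane. -/
lemma IsNontrivialDoubleArch.similar {P : Set E2} (h : IsNontrivialDoubleArch P) {l : ℝ}
    (hl : 0 < l) (f : E2 ≃ᵃⁱ[ℝ] E2) : IsNontrivialDoubleArch ((fun p => f (l • p)) '' P) := by
  obtain ⟨e, a, b, A, A', hab, hA, hA', he⟩ := h
  let g : E2 ≃ᵃⁱ[ℝ] E2 := e.linearIsometryEquiv.toAffineIsometryEquiv.trans
    (AffineIsometryEquiv.constVAdd ℝ E2 (l • e 0))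
  have hg (p : E2) : g (l • p) = l • e p := by
    have h1 : e p = e.linearIsometryEquiv p + e 0 := by
      have := e.map_vadd 0 p
      simpa using this
    change l • e 0 + e.linearIsometryEquiv (l • p) = l • e p
    rw [h1, map_smul, smul_add, add_comm]
  refine ⟨f.symm.trans g, l * a, l * b, _, _, by gcongr, hA.smul hl, hA'.smul hl, ?_⟩
  have h1 : (f.symm.trans g) '' ((fun p => f (l • p)) '' P) = (fun p => l • p) '' (e '' P) := by
    simp only [image_image, AffineIsometryEquiv.coe_trans, Function.comp_apply,
      AffineIsometryEquiv.symm_apply_apply, hg]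
  rw [h1, he, image_union]
  congr 1
  simp only [image_image]
  congr 1
  funext p
  apply ext_E2 <;> simp [flip]

lemma IsRegularPolygon.eq_convexHull_vertices {n : ℕ} {o : E2} {P : Set E2}
    (h : IsRegularPolygon n o P) :
    ∃ s φ : ℝ, 0 < s ∧ P = convexHull ℝ (vertices n o s φ) := h.2

/-- Reciprocation in a concentric circle acts on a regular polygon as a similarity; it therefore
preserves regular polygons that are nontrivial double arches. -/
lemma IsRegularPolygon.polar_doubleArch {n : ℕ} {o : E2} {P : Set E2} {r : ℝ} (hr : 0 < r)
    (h : IsRegularPolygon n o P) (hP : IsNontrivialDoubleArch P) :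
    IsRegularPolygon n o (polar o r P) ∧ IsNontrivialDoubleArch (polar o r P) := by
  have hn := h.1
  obtain ⟨s, φ, hs, rfl⟩ := h.eq_convexHull_vertices
  have hc := cos_pi_div_pos hn
  rw [polar_vertices hn o hs hr]
  set γ := Real.pi / n
  set s' := r ^ 2 / (s * Real.cos γ)
  have hs' : 0 < s' := by positivity
  refine ⟨⟨hn, s', φ + γ, hs', rfl⟩, ?_⟩
  let f : E2 ≃ᵃⁱ[ℝ] E2 := (spin γ).toAffineIsometryEquiv.trans
    (AffineIsometryEquiv.constVAdd ℝ E2 (o - spin γ ((s' / s) • o)))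
  convert hP.similar (div_pos hs' hs) f using 1
  have h1 : (fun p => f ((s' / s) • p)) '' convexHull ℝ (vertices n o s φ) =
      convexHull ℝ ((fun p => f ((s' / s) • p)) '' vertices n o s φ) := by
    have := (f.toAffineEquiv.toAffineMap.comp
      (LinearMap.lsmul ℝ E2 (s' / s)).toAffineMap).image_convexHull (vertices n o s φ)
    exact this
  rw [h1, vertices, vertices, ← range_comp]
  congr 2
  funext k
  have h2 : f ((s' / s) • (o + s • dir (φ + 2 * Real.pi * (k : ℕ) / n))) =
      o + s' • spin γ (dir (φ + 2 * Real.pi * (k : ℕ) / n)) := by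
    change o - spin γ ((s' / s) • o) + spin γ _ = _
    rw [smul_add, map_add, smul_smul, div_mul_cancel₀ _ hs.ne', map_smul _ s']
    abel
  rw [Function.comp_apply, h2]
  congr 2
  rw [show φ + γ + 2 * Real.pi * (k : ℕ) / n = γ + (φ + 2 * Real.pi * (k : ℕ) / n) by ring,
    spin_apply]
  apply ext_E2 <;> simp [Real.cos_add, Real.sin_add]

/-! ### Passing to the standard position -/

lemma IsRegularPolygon.exists_finite_generators {n : ℕ} {o : E2} {P : Set E2}
    (h : IsRegularPolygon n o P) :
    ∃ F : Set E2, F.Finite ∧ F.Nonempty ∧ P = convexHull ℝ F := by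
  obtain ⟨s, φ, -, rfl⟩ := h.eq_convexHull_vertices
  exact ⟨_, finite_range _, ⟨_, ⟨0, by have := h.1; omega⟩, rfl⟩, rfl⟩

lemma rigid_image_rigid_image (g g' : SO3) (t t' : E3) (Q : Set E3) :
    rigid g' t' '' (rigid g t '' Q) = rigid (g' * g) (rotate g' t + t') '' Q := by
  simp only [image_image, rigid_rigid]

lemma HasRegularArchSection.locallyRupert {n : ℕ} {c : E3} {Q : Set E3} (hQ : IsPolyhedron Q)
    (hc : c ∈ interior Q) (h : HasRegularArchSection n c Q) : LocallyRupert Q := by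
  classical
  obtain ⟨g, t, o, P, hgo, hreg, hda, hsec⟩ := h
  have ho : embed o ∈ interior (rigid g t '' Q) := by
    rw [← hgo, ← rigid_image_interior]; exact mem_image_of_mem _ hc
  obtain ⟨F, -, -, hF⟩ := hreg.exists_finite_generators
  have hPc : Convex ℝ P := hF ▸ convex_convexHull ℝ F
  obtain ⟨e, b, hC⟩ := hda.exists_centred
  obtain ⟨g', t', d, -, hlift⟩ := exists_rigid_lift e
  obtain ⟨V, hV⟩ := hQ.rigid_image g t
  have hQc : Convex ℝ (rigid g t '' Q) := hV ▸ convex_convexHull ℝ _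
  refine ⟨g' * g, rotate g' t + t', ?_⟩
  rw [← rigid_image_rigid_image]
  have himg : rigid g' t' '' (rigid g t '' Q) =
      convexHull ℝ ((V.image (rigid g' t') : Finset E3) : Set E3) := by
    rw [hV, rigid_image_convexHull, Finset.coe_image]
  rw [himg]
  apply hC.orientedLocallyRupert (hPc.affine_image e.toAffineEquiv.toAffineMap)
  · intro v hv
    obtain ⟨w, hw, rfl⟩ := Finset.mem_image.1 hv
    have hwQ : w ∈ rigid g t '' Q := by rw [hV]; exact subset_convexHull ℝ _ hw
    rw [(hlift w).1, (hlift w).2]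
    refine ⟨mem_image_of_mem e (hsec.proj_mem hQc ho hwQ), ?_⟩
    rcases hsec.interior_or hQc ho hwQ with hi | h0
    · left
      have : e '' interior P = interior (e '' P) := e.toHomeomorph.image_interior P
      rw [← this]
      exact mem_image_of_mem e hi
    · right
      rw [h0, mul_zero]
  · rintro _ ⟨p, hp, rfl⟩
    rw [← himg]
    refine ⟨_, mem_image_of_mem _ (hsec.embed_mem hp), ?_⟩
    rw [(hlift _).1, proj_embed]

lemma HasRegularArchPrismSection.locallyReverseRupert {n : ℕ} {c : E3} {D : Set E3}
    (hD : Convex ℝ D) (h : HasRegularArchPrismSection n c D) : LocallyReverseRupert D := by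
  obtain ⟨g, t, o, P, R, -, hreg, hda, hsec⟩ := h
  obtain ⟨F, hFfin, hFne, hF⟩ := hreg.exists_finite_generators
  obtain ⟨e, b, hC⟩ := hda.exists_centred
  obtain ⟨g', t', d, hd, hlift⟩ := exists_rigid_lift e
  have hDc : Convex ℝ (rigid g t '' D) := by
    rw [← coe_rigidEquiv]; exact hD.affine_image (rigidEquiv g t).toAffineEquiv.toAffineMap
  have hDc' : Convex ℝ (rigid g' t' '' (rigid g t '' D)) := by
    rw [← coe_rigidEquiv g']; exact hDc.affine_image (rigidEquiv g' t').toAffineEquiv.toAffineMap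
  obtain ⟨δ, hδ, hslab⟩ := hsec.exists_slab
  have heF : e '' P = convexHull ℝ (e '' F) := by
    rw [hF]; exact e.toAffineEquiv.toAffineMap.image_convexHull F
  refine ⟨g' * g, rotate g' t + t', ?_⟩
  rw [← rigid_image_rigid_image]
  rw [heF] at hC
  have hd1 : |d| = 1 := by
    rcases eq_or_eq_neg_of_sq_eq_sq d 1 (by simpa using hd) with rfl | rfl <;> simp
  refine hC.orientedLocallyReverseRupert (hFfin.image e) hDc' hδ ?_ ?_
  · intro y hy hyP
    obtain ⟨x, rfl⟩ : ∃ x, rigid g' t' x = y := by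
      rw [← coe_rigidEquiv]; exact (rigidEquiv g' t').surjective y
    rw [(hlift x).2, abs_mul, hd1, one_mul] at hy
    rw [(hlift x).1, ← heF, e.injective.mem_set_image] at hyP
    exact mem_image_of_mem _ ((hslab x hy).2 hyP)
  · rintro _ ⟨x, hx, rfl⟩
    rw [(hlift x).1, ← heF]
    refine mem_image_of_mem e (hsec.proj_mem hDc ?_ ?_ hx)
    · rw [hF]; exact hFfin.isCompact_convexHull (𝕜 := ℝ)
    · rw [hF]; exact hFne.convexHull

lemma hasRegularArchSection_iff_dual {n : ℕ} {c : E3} {Q : Set E3} {r : ℝ} (hQ : IsPolyhedron Q)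
    (hc : c ∈ interior Q) (hr : 0 < r) :
    HasRegularArchSection n c Q ↔ HasRegularArchPrismSection n c (dual c r Q) := by
  have ho {g : SO3} {t : E3} {o : E2} (hgo : rigid g t c = embed o) :
      embed o ∈ interior (rigid g t '' Q) := by
    rw [← hgo, ← rigid_image_interior]; exact mem_image_of_mem _ hc
  constructor
  · rintro ⟨g, t, o, P, hgo, hreg, hda, hsec⟩
    obtain ⟨hreg', hda'⟩ := hreg.polar_doubleArch hr hda
    obtain ⟨R, hR⟩ := hsec.dual_prismSection hr (hQ.rigid_image g t) (ho hgo)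
    refine ⟨g, t, o, _, R, hgo, hreg', hda', ?_⟩
    rwa [rigid_image_dual, hgo]
  · rintro ⟨g, t, o, P, R, hgo, hreg, hda, hsec⟩
    obtain ⟨hreg', hda'⟩ := hreg.polar_doubleArch hr hda
    obtain ⟨F, hFfin, hFne, rfl⟩ := hreg.exists_finite_generators
    rw [rigid_image_dual, hgo] at hsec
    exact ⟨g, t, o, _, hgo, hreg', hda',
      hsec.polygonalSection hFfin hFne hr (hQ.rigid_image g t) (ho hgo)⟩

end LocalRupert

end

theorem mainTheorem7 (Q : Set LocalRupert.E3) (hQ : LocalRupert.IsPolyhedron Q)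
    (c : LocalRupert.E3) (hc : c ∈ interior Q) (r : ℝ) (hr : 0 < r) (n : ℕ) :
    (LocalRupert.HasRegularArchSection n c Q ↔
      LocalRupert.HasRegularArchPrismSection n c (LocalRupert.dual c r Q)) ∧
    (LocalRupert.HasRegularArchSection n c Q → LocalRupert.LocallyRupert Q) ∧
    (LocalRupert.HasRegularArchPrismSection n c (LocalRupert.dual c r Q) →
      LocalRupert.LocallyReverseRupert (LocalRupert.dual c r Q)) := by
  exact ⟨LocalRupert.hasRegularArchSection_iff_dual hQ hc hr,
    fun h => h.locallyRupert hQ hc,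
    fun h => h.locallyReverseRupert (LocalRupert.convex_dual c r Q)⟩
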